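/- **Setting.** Let $1\le d\le n$, let $\mathrm{Gr}(n,d)$ be the set of $d$-dimensional subspaces of $\mathbb R^n$, $P_{\mathbf U}$ the orthogonal projection onto $\mathbf U$, $P_{\mathbf U}^\perp=I_n-P_{\mathbf U}$, $d_2(\mathbf U,\mathbf V)=\big(\mathrm{tr}(P_{\mathbf U}^\perp P_{\mathbf V})\big)^{1/2}$ the chordal distance, and $\mathbb B_r(\mathbf U)=\{\mathbf V\in\mathrm{Gr}(n,d): d_2(\mathbf U,\mathbf V)\le r\}$. For $f:\mathrm{Gr}(n,d)\to\mathbb R$ the Riemannian gradient at $\mathbf U$ is represented, at a matrix $U$ with $U^\top U=I_d$ whose columns span $\mathbf U$, by $\mathrm{grad} f(\mathbf U)=(I_n-UU^\top)\nabla\bar f(U)$, where $\bar f:\mathbb R^{n\times d}\to\mathbb R$ is differentiable at $U$ and $\bar f(Y)=f(\mathrm{span}\,Y)$ for every $Y$ with orthonormal columns. For a tangent vector represented by $V$ ($U^\top V=0$) with compact SVD $V=Q_1\Sigma Q_2^\top$, $\mathrm{Exp}_{\mathbf U}(V)$ is the span of the columns of $UQ_2\cos(\Sigma)Q_2^\top+Q_1\sin(\Sigma)Q_2^\top$.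 $\sigma_i(A)$ denotes the $i$-th largest singular value of $A$. **Data and algorithm.** Let $\mathbf U_t\in\mathrm{Gr}(n,d)$ (true subspaces) and $u_t\in\mathbb R^n$ (samples) for $t\ge1$, and let $t_0\ge d$, $T\in\{d,\dots,t_0+1\}$, $K\ge1$ be integers. For $t\ge T$ put $W_t=[u_{t-T+1}\ \dots\ u_t]\in\mathbb R^{n\times T}$. Let $F_{W}(\mathbf U)=\|P_{\mathbf U}^\perp W\|_F^2$. Given an initial estimate $\hat{\mathbf U}_{t_0}\in\mathrm{Gr}(n,d)$ and a step size $\alpha$, the algorithm GREAT computes, for $t=t_0+1,t_0+2,\dots$, $\hat{\mathbf U}_t^0=\hat{\mathbf U}_{t-1}$, then $\hat{\mathbf U}_t^{k+1}=\mathrm{Exp}_{\hat{\mathbf U}_t^k}\big(-\alpha\,\mathrm{grad}F_{W_t}(\hat{\mathbf U}_t^k)\big)$ for $k=0,\dots,K-1$, and $\hat{\mathbf U}_t=\hat{\mathbf U}_t^K$. **Assumptions.** 1. For all $t\ge1$: $u_t=\bar u_t+e_t$ with $\bar u_t\in\mathbf U_t$ and $\|e_t\|_2\le\epsilon$. 2.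 $c\ge0$ and $d_2(\mathbf U_t,\mathbf U_{t+1})\le c$ for all $t\ge1$. 3. $0<\underline\sigma\le\overline\sigma$, and $\sigma_1(P_{\mathbf U_t}W_t)\le\overline\sigma$, $\sigma_d(P_{\mathbf U_t}W_t)\ge\underline\sigma$ for all $t\ge T$. 4. $0<\alpha<\underline\sigma^2/(2\overline\sigma^4)$; $c\le r_b<1$; $\hat{\mathbf U}_{t_0}\in\mathbb B_{r_b}(\mathbf U_{t_0+1})$; $\tilde\rho:=1-4(1-r_b^2)(\alpha\underline\sigma^2-2\alpha^2\overline\sigma^4)\ge0$; and for all $t\ge t_0+1$ $$\gamma_{r_b}(\delta_t)\le(1-\tilde\rho)r_b^2+\frac{(1-\tilde\rho)(c^2-2cr_b)}{1-\tilde\rho^K},$$ where $\delta_t=c\,\|W_tD\|_F+\epsilon\sqrt T\,(c(T-1)+1)$ with $D=\mathrm{diag}(T-1,T-2,\dots,0)$, and $$\gamma_r(\delta)=8\alpha r\overline\sigma(1+4\alpha\overline\sigma^2)\delta+\big(4\alpha r+16\alpha^2\overline\sigma^2(r+2)\big)\delta^2+32\alpha^2\overline\sigma\delta^3+8\alpha^2\delta^4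 .$$ **Lemma 4 (Gradient dominance).** Under Assumptions 1–4, for all $t\ge t_0+1$ and all $k=0,\dots,K$: 1. $\hat{\mathbf U}_t^k\in\mathbb B_{r_b}(\mathbf U_t)$; 2. the function $\mathbf V\mapsto d_2(\mathbf V,\mathbf U_t)^2$ has a Riemannian gradient at $\hat{\mathbf U}_t^k$, and $\big\|\mathrm{grad}\,d_2(\hat{\mathbf U}_t^k,\mathbf U_t)^2\big\|_F^2\ge4(1-r_b^2)\,d_2(\hat{\mathbf U}_t^k,\mathbf U_t)^2$ (gradient with respect to the first argument). -/

import Mathlib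

namespace GREAT

/-- The Grassmannian: the `d`-dimensional linear subspaces of Euclidean `ℝⁿ`. -/
abbrev Grass (n d : ℕ) : Type :=
  {U : Submodule ℝ (EuclideanSpace ℝ (Fin n)) // Module.finrank ℝ U = d}

/-- The span of the columns of a matrix. -/
def colSpan {n d : ℕ} (X : Matrix (Fin n) (Fin d) ℝ) :
    Submodule ℝ (EuclideanSpace ℝ (Fin n)) :=
  Submodule.span ℝ (Set.range fun j : Fin d => WithLp.toLp 2 fun i : Fin n => X i j)

/-- `X` is a matrix representation of `U`: its columns are orthonormal and span `U`. -/
def IsRep {n d : ℕ} (X : Matrix (Fin n) (Fin d) ℝ) (U : Grass n d) : Prop :=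
  X.transpose * X = 1 ∧ colSpan X = U.1

/-- The matrix `P_U` of the orthogonal projection onto the subspace `U`. -/
noncomputable def proj {n d : ℕ} (U : Grass n d) : Matrix (Fin n) (Fin n) ℝ :=
  Matrix.toEuclideanLin.symm
    (U.1.starProjection : EuclideanSpace ℝ (Fin n) →ₗ[ℝ] EuclideanSpace ℝ (Fin n))

/-- The Frobenius norm. -/
noncomputable def frobNorm {m k : ℕ} (A : Matrix (Fin m) (Fin k) ℝ) : ℝ :=
  Real.sqrt (∑ i, ∑ j, A i j ^ 2)

/-- The `i`-th largest singular value (`i = 1, 2, …`) of a matrix; Mathlib counts from zero. -/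
noncomputable def sigma {m k : ℕ} (i : ℕ) (A : Matrix (Fin m) (Fin k) ℝ) : ℝ :=
  (Matrix.toEuclideanLin A).singularValues (i - 1)

/-- The chordal distance `d₂(U, V) = (tr (P_U^⊥ P_V))^{1/2}`. -/
noncomputable def chordal {n d : ℕ} (U V : Grass n d) : ℝ :=
  Real.sqrt (Matrix.trace ((1 - proj U) * proj V))

/-- The closed chordal ball of radius `r` around `U`. -/
def chordalBall {n d : ℕ} (r : ℝ) (U : Grass n d) : Set (Grass n d) :=
  {V | chordal U V ≤ r}

/-- `G` represents, at the orthonormal representation `X` of a point, the Riemannian gradient of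
`f : Gr(n, d) → ℝ`: that is `G = (I - X Xᵀ) g`, where `g` is the Euclidean gradient at `X` (for the
Frobenius inner product) of an extension `fbar : ℝ^{n×d} → ℝ` of `f`, i.e. of a function with
`fbar Y = f V` for all orthonormal representations `Y` of subspaces `V`, that is differentiable
at `X`. The value `G` does not depend on the choice of the extension. -/
def HasRiemannianGradAt {n d : ℕ} (f : Grass n d → ℝ) (X G : Matrix (Fin n) (Fin d) ℝ) : Prop :=
  ∃ (fbar : Matrix (Fin n) (Fin d) ℝ → ℝ) (L : Matrix (Fin n) (Fin d) ℝ →L[ℝ] ℝ)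
    (g : Matrix (Fin n) (Fin d) ℝ),
    (∀ (V : Grass n d) (Y : Matrix (Fin n) (Fin d) ℝ), IsRep Y V → fbar Y = f V) ∧
    HasFDerivAt fbar L X ∧
    (∀ H, L H = Matrix.trace (g.transpose * H)) ∧
    G = (1 - X * X.transpose) * g

/-- `V = Q₁ diag(s) Q₂ᵀ` is a compact singular value decomposition; only the columns of `Q₁` that
belong to nonzero singular values matter, and these are orthonormal. -/
def IsCompactSVD {n d : ℕ} (V Q₁ : Matrix (Fin n) (Fin d) ℝ) (s : Fin d → ℝ)
    (Q₂ : Matrix (Fin d) (Fin d) ℝ) : Prop :=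
  (∀ i, 0 ≤ s i) ∧
  Q₂.transpose * Q₂ = 1 ∧
  (∀ i j, s i ≠ 0 → s j ≠ 0 → (Q₁.transpose * Q₁) i j = if i = j then 1 else 0) ∧
  V = Q₁ * Matrix.diagonal s * Q₂.transpose

/-- `U'` is the image under the exponential map of the Grassmannian of the tangent vector
represented by `V` at the point represented by `X`:
`U'` is spanned by `X Q₂ cos(Σ) Q₂ᵀ + Q₁ sin(Σ) Q₂ᵀ` with `V = Q₁ Σ Q₂ᵀ` a compact SVD. -/
def IsExp {n d : ℕ} (X V : Matrix (Fin n) (Fin d) ℝ) (U' : Grass n d) : Prop :=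
  ∃ (Q₁ : Matrix (Fin n) (Fin d) ℝ) (s : Fin d → ℝ) (Q₂ : Matrix (Fin d) (Fin d) ℝ),
    IsCompactSVD V Q₁ s Q₂ ∧
    U'.1 = colSpan (X * Q₂ * Matrix.diagonal (fun i => Real.cos (s i)) * Q₂.transpose
      + Q₁ * Matrix.diagonal (fun i => Real.sin (s i)) * Q₂.transpose)

/-- The data window `W_t = [u_{t-T+1} … u_t]`, used for `t ≥ T` only. -/
def window {n : ℕ} (u : ℕ → EuclideanSpace ℝ (Fin n)) (T t : ℕ) : Matrix (Fin n) (Fin T) ℝ :=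
  Matrix.of fun i j => u (t - T + 1 + (j : ℕ)) i

/-- The cost `F_W(U) = ‖P_U^⊥ W‖_F²`. -/
noncomputable def cost {n d T : ℕ} (W : Matrix (Fin n) (Fin T) ℝ) (U : Grass n d) : ℝ :=
  frobNorm ((1 - proj U) * W) ^ 2

/-- One gradient descent step `U' = Exp_U (-α grad F_W(U))`, computed with some orthonormal
representation `X` of `U`. -/
def IsGradStep {n d T : ℕ} (α : ℝ) (W : Matrix (Fin n) (Fin T) ℝ) (U U' : Grass n d) : Prop :=
  ∃ X G : Matrix (Fin n) (Fin d) ℝ,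
    IsRep X U ∧ HasRiemannianGradAt (cost W) X G ∧ IsExp X (-(α • G)) U'

/-- `est t` (`t ≥ t₀`) are the estimates and `iter t k` (`t > t₀`, `0 ≤ k ≤ K`) the inner iterates
produced by the algorithm GREAT from the samples `u`, started at `est t₀`. -/
structure IsRun {n d : ℕ} (u : ℕ → EuclideanSpace ℝ (Fin n)) (T t₀ K : ℕ) (α : ℝ)
    (est : ℕ → Grass n d) (iter : ℕ → ℕ → Grass n d) : Prop where
  init : ∀ t, t₀ + 1 ≤ t → iter t 0 = est (t - 1)
  step : ∀ t, t₀ + 1 ≤ t → ∀ k < K, IsGradStep α (window u T t) (iter t k) (iter t (k + 1))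
  update : ∀ t, t₀ + 1 ≤ t → est t = iter t K

/-- The noise bound `δ_t = c ‖W_t D‖_F + ε √T (c (T - 1) + 1)`, `D = diag(T-1, T-2, …, 0)`. -/
noncomputable def delta {n : ℕ} (u : ℕ → EuclideanSpace ℝ (Fin n)) (T : ℕ) (ε c : ℝ) (t : ℕ) : ℝ :=
  c * frobNorm (window u T t * Matrix.diagonal fun j : Fin T => (T : ℝ) - 1 - (j : ℕ))
    + ε * Real.sqrt T * (c * ((T : ℝ) - 1) + 1)

/-- The polynomial `γ_r`; `σhi` is the upper bound on the singular values of the signal. -/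
noncomputable def gamma (α σhi r δ : ℝ) : ℝ :=
  8 * α * r * σhi * (1 + 4 * α * σhi ^ 2) * δ
    + (4 * α * r + 16 * α ^ 2 * σhi ^ 2 * (r + 2)) * δ ^ 2
    + 32 * α ^ 2 * σhi * δ ^ 3 + 8 * α ^ 2 * δ ^ 4

/-- The contraction factor `1 - 4 (1 - r²) (α σlo² - 2 α² σhi⁴)`. -/
noncomputable def rhoTilde (α σlo σhi r : ℝ) : ℝ :=
  1 - 4 * (1 - r ^ 2) * (α * σlo ^ 2 - 2 * α ^ 2 * σhi ^ 4)

end GREAT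

/-! Fix a time `t`, put `S = U t`, and let `h k` be the squared chordal distance from `S` to the
`k`-th inner iterate. Everything rests on a one-step estimate `h (k+1) ≤ ρ̃ * h k + γ` inside the
ball of radius `r_b` (`IsGradStep.chordal_sq_le`). An exponential step rotates each principal
direction by an angle `s j`, and for angles up to `3/2` the squared distance obeys a second-order
upper bound (`IsExp.chordal_sq_le`). Split `W` into `A = P_S W` and `N = P_S^⊥ W`. The signal part
of the gradient gives a first-order gain of `4 α σlo² g²` and a curvature loss of at most `8 α² σhi⁴
g²`, with `g = ‖P_S^⊥ P_U P_S‖_F`. All terms containing `N` go into `γ`, since `‖N‖_F ≤ δ_t`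
(`frobNorm_mul_window_le_delta`). In the ball `g² ≥ (1 - r_b²) h` (`sqrt_mul_chordal_le_frobNorm`),
which produces `ρ̃`.

The signal-to-noise condition is tuned to this affine recursion: the iterates stay in the ball, and
after `K` steps the distance is at most `r_b - c` (`affine_recursion_bound`). The true subspace then
moves by at most `c`, so the next window again starts in the ball. The same condition bounds the
rotation angles (`step_length_le_of_gamma_le`).

Gradient dominance is then the inequality for `g` with the two subspaces exchanged, because the
gradient of the squared distance has norm `2 ‖P_U P_S P_U^⊥‖_F`. As gradients are given by arbitrary
extensions, `HasRiemannianGradAt.unique` is needed to compute with explicit formulas. -/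

namespace GREAT

open Matrix

/-! ### Frobenius and operator norm estimates -/

section Frobenius

variable {l m k : ℕ}

/-- `A` is bounded by `s` as an operator between Euclidean spaces. -/
def OpLe (A : Matrix (Fin m) (Fin k) ℝ) (s : ℝ) : Prop :=
  0 ≤ s ∧ ∀ x : EuclideanSpace ℝ (Fin k), ‖toEuclideanLin A x‖ ≤ s * ‖x‖

/-- The `j`-th column as a vector of Euclidean space. -/
def colVec (A : Matrix (Fin m) (Fin k) ℝ) (j : Fin k) : EuclideanSpace ℝ (Fin m) :=
  WithLp.toLp 2 fun i => A i j

@[simp] lemma colVec_apply (A : Matrix (Fin m) (Fin k) ℝ) (j : Fin k) (i : Fin m) :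
    colVec A j i = A i j := rfl

lemma frobNorm_nonneg (A : Matrix (Fin m) (Fin k) ℝ) : 0 ≤ frobNorm A := Real.sqrt_nonneg _

lemma frobNorm_sq (A : Matrix (Fin m) (Fin k) ℝ) : frobNorm A ^ 2 = ∑ i, ∑ j, A i j ^ 2 :=
  Real.sq_sqrt (Finset.sum_nonneg fun _ _ => Finset.sum_nonneg fun _ _ => sq_nonneg _)

lemma frobNorm_sq_eq_trace (A : Matrix (Fin m) (Fin k) ℝ) :
    frobNorm A ^ 2 = trace (Aᵀ * A) := by
  rw [frobNorm_sq, Finset.sum_comm]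
  simp [trace, mul_apply, sq]

lemma frobNorm_sq_eq_sum_colVec (A : Matrix (Fin m) (Fin k) ℝ) :
    frobNorm A ^ 2 = ∑ j, ‖colVec A j‖ ^ 2 := by
  rw [frobNorm_sq, Finset.sum_comm]
  simp [EuclideanSpace.norm_sq_eq]

lemma frobNorm_transpose (A : Matrix (Fin m) (Fin k) ℝ) : frobNorm Aᵀ = frobNorm A := by
  rw [frobNorm, frobNorm, Finset.sum_comm]
  rfl

/-- Flattening to a Euclidean vector makes the triangle inequality and Cauchy–Schwarz available. -/
lemma frobNorm_eq_norm (A : Matrix (Fin m) (Fin k) ℝ) :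
    frobNorm A = ‖(WithLp.toLp 2 fun p : Fin m × Fin k => A p.1 p.2 :
      EuclideanSpace ℝ (Fin m × Fin k))‖ := by
  rw [EuclideanSpace.norm_eq, frobNorm, Fintype.sum_prod_type]
  simp

lemma frobNorm_add_le (A B : Matrix (Fin m) (Fin k) ℝ) :
    frobNorm (A + B) ≤ frobNorm A + frobNorm B := by
  simp only [frobNorm_eq_norm]
  exact norm_add_le
    (WithLp.toLp 2 fun p : Fin m × Fin k => A p.1 p.2 : EuclideanSpace ℝ (Fin m × Fin k))
    (WithLp.toLp 2 fun p : Fin m × Fin k => B p.1 p.2)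

lemma frobNorm_smul (a : ℝ) (A : Matrix (Fin m) (Fin k) ℝ) :
    frobNorm (a • A) = |a| * frobNorm A := by
  simp only [frobNorm_eq_norm]
  rw [← Real.norm_eq_abs, ← norm_smul]
  rfl

lemma frobNorm_neg (A : Matrix (Fin m) (Fin k) ℝ) : frobNorm (-A) = frobNorm A := by
  simpa using frobNorm_smul (-1) A

lemma abs_trace_transpose_mul_le (A B : Matrix (Fin m) (Fin k) ℝ) :
    |trace (Aᵀ * B)| ≤ frobNorm A * frobNorm B := by
  have h := abs_real_inner_le_norm
    (WithLp.toLp 2 fun p : Fin m × Fin k => A p.1 p.2 : EuclideanSpace ℝ (Fin m × Fin k))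
    (WithLp.toLp 2 fun p : Fin m × Fin k => B p.1 p.2)
  rw [← frobNorm_eq_norm, ← frobNorm_eq_norm] at h
  convert h using 2
  rw [PiLp.inner_apply, Fintype.sum_prod_type, Finset.sum_comm]
  simp [trace, mul_apply, mul_comm]

lemma colVec_mul (A : Matrix (Fin l) (Fin m) ℝ) (B : Matrix (Fin m) (Fin k) ℝ) (j : Fin k) :
    colVec (A * B) j = toEuclideanLin A (colVec B j) := by
  ext i
  simp [mul_apply, mulVec, dotProduct]

lemma norm_colVec_le (A : Matrix (Fin m) (Fin k) ℝ) (j : Fin k) : ‖colVec A j‖ ≤ frobNorm A := by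
  refine abs_le_of_sq_le_sq' ?_ (frobNorm_nonneg A) |>.2
  rw [frobNorm_sq_eq_sum_colVec]
  exact Finset.single_le_sum (f := fun j => ‖colVec A j‖ ^ 2) (fun _ _ => sq_nonneg _)
    (Finset.mem_univ j)

lemma frobNorm_mul_le_of_colVec {A : Matrix (Fin l) (Fin m) ℝ} {B : Matrix (Fin m) (Fin k) ℝ}
    {s : ℝ} (hs : 0 ≤ s) (h : ∀ j, ‖toEuclideanLin A (colVec B j)‖ ≤ s * ‖colVec B j‖) :
    frobNorm (A * B) ≤ s * frobNorm B := by
  refine abs_le_of_sq_le_sq' ?_ (mul_nonneg hs (frobNorm_nonneg B)) |>.2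
  rw [mul_pow, frobNorm_sq_eq_sum_colVec, frobNorm_sq_eq_sum_colVec, Finset.mul_sum]
  refine Finset.sum_le_sum fun j _ => ?_
  rw [colVec_mul, ← mul_pow]
  exact pow_le_pow_left₀ (norm_nonneg _) (h j) 2

/-- Expansion is required on the columns of `B` only: in the applications it holds just on a
subspace containing them. -/
lemma le_frobNorm_mul_of_colVec {A : Matrix (Fin l) (Fin m) ℝ} {B : Matrix (Fin m) (Fin k) ℝ}
    {s : ℝ} (hs : 0 ≤ s) (h : ∀ j, s * ‖colVec B j‖ ≤ ‖toEuclideanLin A (colVec B j)‖) :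
    s * frobNorm B ≤ frobNorm (A * B) := by
  refine abs_le_of_sq_le_sq' ?_ (frobNorm_nonneg _) |>.2
  rw [mul_pow, frobNorm_sq_eq_sum_colVec, frobNorm_sq_eq_sum_colVec, Finset.mul_sum]
  refine Finset.sum_le_sum fun j _ => ?_
  rw [colVec_mul, ← mul_pow]
  exact pow_le_pow_left₀ (mul_nonneg hs (norm_nonneg _)) (h j) 2

lemma frobNorm_mul_le {A : Matrix (Fin l) (Fin m) ℝ} {s : ℝ} (hA : OpLe A s)
    (B : Matrix (Fin m) (Fin k) ℝ) : frobNorm (A * B) ≤ s * frobNorm B :=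
  frobNorm_mul_le_of_colVec hA.1 fun j => hA.2 (colVec B j)

lemma inner_toEuclideanLin (A : Matrix (Fin m) (Fin k) ℝ) (x : EuclideanSpace ℝ (Fin k))
    (y : EuclideanSpace ℝ (Fin m)) :
    inner ℝ (toEuclideanLin A x) y = inner ℝ x (toEuclideanLin Aᵀ y) := by
  rw [← conjTranspose_eq_transpose_of_trivial, toEuclideanLin_conjTranspose_eq_adjoint,
    LinearMap.adjoint_inner_right]

lemma toEuclideanLin_mul_apply (A : Matrix (Fin l) (Fin m) ℝ) (B : Matrix (Fin m) (Fin k) ℝ)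
    (x : EuclideanSpace ℝ (Fin k)) :
    toEuclideanLin (A * B) x = toEuclideanLin A (toEuclideanLin B x) := by
  ext i
  simp [mulVec_mulVec]

lemma OpLe.transpose {A : Matrix (Fin m) (Fin k) ℝ} {s : ℝ} (hA : OpLe A s) : OpLe Aᵀ s := by
  refine ⟨hA.1, fun y => ?_⟩
  rcases (norm_nonneg (toEuclideanLin Aᵀ y)).eq_or_lt with h0 | h0
  · rw [← h0]
    exact mul_nonneg hA.1 (norm_nonneg _)
  · refine le_of_mul_le_mul_right ?_ h0
    calc ‖toEuclideanLin Aᵀ y‖ * ‖toEuclideanLin Aᵀ y‖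
        = inner ℝ (toEuclideanLin A (toEuclideanLin Aᵀ y)) y := by
          rw [inner_toEuclideanLin, real_inner_self_eq_norm_mul_norm]
      _ ≤ ‖toEuclideanLin A (toEuclideanLin Aᵀ y)‖ * ‖y‖ := real_inner_le_norm _ _
      _ ≤ s * ‖toEuclideanLin Aᵀ y‖ * ‖y‖ :=
          mul_le_mul_of_nonneg_right (hA.2 _) (norm_nonneg _)
      _ = s * ‖y‖ * ‖toEuclideanLin Aᵀ y‖ := by ring

lemma OpLe.mul {A : Matrix (Fin l) (Fin m) ℝ} {B : Matrix (Fin m) (Fin k) ℝ} {s r : ℝ}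
    (hA : OpLe A s) (hB : OpLe B r) : OpLe (A * B) (s * r) := by
  refine ⟨mul_nonneg hA.1 hB.1, fun x => ?_⟩
  rw [toEuclideanLin_mul_apply, mul_assoc]
  exact (hA.2 _).trans (mul_le_mul_of_nonneg_left (hB.2 x) hA.1)

lemma frobNorm_mul_le_right {A : Matrix (Fin m) (Fin k) ℝ} {s : ℝ} (hA : OpLe A s)
    (B : Matrix (Fin l) (Fin m) ℝ) : frobNorm (B * A) ≤ frobNorm B * s := by
  rw [← frobNorm_transpose (B * A), transpose_mul, ← frobNorm_transpose B, mul_comm _ s]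
  exact frobNorm_mul_le hA.transpose _

lemma opLe_frobNorm (A : Matrix (Fin m) (Fin k) ℝ) : OpLe A (frobNorm A) := by
  refine ⟨frobNorm_nonneg A, fun x => ?_⟩
  refine abs_le_of_sq_le_sq' ?_ (mul_nonneg (frobNorm_nonneg A) (norm_nonneg x)) |>.2
  rw [mul_pow, frobNorm_sq, EuclideanSpace.norm_sq_eq, EuclideanSpace.norm_sq_eq, Finset.sum_mul]
  refine Finset.sum_le_sum fun i _ => ?_
  simp only [Real.norm_eq_abs, sq_abs, toLpLin_apply, mulVec, dotProduct]
  exact Finset.sum_mul_sq_le_sq_mul_sq _ _ _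

lemma norm_toEuclideanLin_of_isometry {X : Matrix (Fin m) (Fin k) ℝ} (hX : Xᵀ * X = 1)
    (x : EuclideanSpace ℝ (Fin k)) : ‖toEuclideanLin X x‖ = ‖x‖ := by
  have h : inner ℝ (toEuclideanLin X x) (toEuclideanLin X x) = inner ℝ x x := by
    rw [inner_toEuclideanLin, ← toEuclideanLin_mul_apply, hX]
    simp [toLpLin_one]
  rw [real_inner_self_eq_norm_sq, real_inner_self_eq_norm_sq] at h
  exact (sq_eq_sq₀ (norm_nonneg _) (norm_nonneg _)).1 h

lemma opLe_of_isometry {X : Matrix (Fin m) (Fin k) ℝ} (hX : Xᵀ * X = 1) : OpLe X 1 :=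
  ⟨zero_le_one, fun x => by rw [norm_toEuclideanLin_of_isometry hX, one_mul]⟩

lemma opLe_one_of_projection {P : Matrix (Fin m) (Fin m) ℝ} (hs : Pᵀ = P) (hi : P * P = P) :
    OpLe P 1 := by
  refine ⟨zero_le_one, fun x => ?_⟩
  rw [one_mul]
  have h : ‖toEuclideanLin P x‖ ^ 2 ≤ ‖toEuclideanLin P x‖ * ‖x‖ := by
    calc ‖toEuclideanLin P x‖ ^ 2 = inner ℝ (toEuclideanLin P x) x := by
          rw [← real_inner_self_eq_norm_sq, inner_toEuclideanLin, ← toEuclideanLin_mul_apply, hs,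
            hi, real_inner_comm]
      _ ≤ _ := real_inner_le_norm _ _
  by_contra hc
  push Not at hc
  have := norm_nonneg x
  nlinarith

lemma frobNorm_sq_eq_trace_of_projection {P : Matrix (Fin m) (Fin m) ℝ} (hs : Pᵀ = P)
    (hi : P * P = P) (A : Matrix (Fin m) (Fin k) ℝ) :
    frobNorm (P * A) ^ 2 = trace (Aᵀ * P * A) := by
  rw [frobNorm_sq_eq_trace, transpose_mul, hs]
  congr 1
  simp only [Matrix.mul_assoc]
  rw [← Matrix.mul_assoc P P, hi]

end Frobenius

/-! ### Singular values as expansion bounds -/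

section SingularValues

open Module

variable {E F : Type*} [NormedAddCommGroup E] [InnerProductSpace ℝ E] [FiniteDimensional ℝ E]
  [NormedAddCommGroup F] [InnerProductSpace ℝ F] [FiniteDimensional ℝ F]

/-- `‖T x‖²` is the quadratic form of `T* T`, which the eigenbasis diagonalises with eigenvalues the
squared singular values. -/
lemma norm_sq_apply_eq_sum_singularValues (T : E →ₗ[ℝ] F) (x : E) :
    ‖T x‖ ^ 2 = ∑ i : Fin (finrank ℝ E), T.singularValues i ^ 2 *
      inner ℝ (T.isSymmetric_adjoint_comp_self.eigenvectorBasis rfl i) x ^ 2 := by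
  set b := T.isSymmetric_adjoint_comp_self.eigenvectorBasis rfl
  have h1 : ‖T x‖ ^ 2 = inner ℝ ((T.adjoint ∘ₗ T) x) x := by
    rw [LinearMap.comp_apply, LinearMap.adjoint_inner_left, real_inner_self_eq_norm_sq]
  rw [h1, ← b.sum_inner_mul_inner]
  refine Finset.sum_congr rfl fun i _ => ?_
  rw [T.isSymmetric_adjoint_comp_self x (b i),
    T.isSymmetric_adjoint_comp_self.apply_eigenvectorBasis rfl i, T.sq_singularValues_fin rfl,
    inner_smul_right, real_inner_comm]
  simp only [RCLike.ofReal_real_eq_id, id]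
  ring

lemma norm_apply_le_singularValues_zero (T : E →ₗ[ℝ] F) (x : E) :
    ‖T x‖ ≤ T.singularValues 0 * ‖x‖ := by
  refine abs_le_of_sq_le_sq' ?_ (mul_nonneg (T.singularValues_nonneg 0) (norm_nonneg x)) |>.2
  rw [norm_sq_apply_eq_sum_singularValues, mul_pow,
    ← (T.isSymmetric_adjoint_comp_self.eigenvectorBasis rfl).sum_sq_inner_right x, Finset.mul_sum]
  exact Finset.sum_le_sum fun i _ => mul_le_mul_of_nonneg_right
    (pow_le_pow_left₀ (T.singularValues_nonneg _) (T.singularValues_antitone (Nat.zero_le _)) 2)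
    (sq_nonneg _)

/-- On some `d`-dimensional subspace a linear map expands by at least its `d`-th singular value. -/
lemma exists_submodule_singularValues_le (T : E →ₗ[ℝ] F) {d : ℕ} (hd : d ≤ finrank ℝ E) :
    ∃ M : Submodule ℝ E, finrank ℝ M = d ∧
      ∀ x ∈ M, T.singularValues (d - 1) * ‖x‖ ≤ ‖T x‖ := by
  set b := T.isSymmetric_adjoint_comp_self.eigenvectorBasis rfl with hb
  -- The span of the first `d` eigenvectors of `T* T`; its elements are orthogonal to the later
  -- ones, so only the `d` largest singular values enter.
  refine ⟨Submodule.span ℝ (Set.range (b ∘ Fin.castLE hd)), ?_, fun x hx => ?_⟩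
  · rw [finrank_span_eq_card, Fintype.card_fin]
    exact b.orthonormal.linearIndependent.comp _ (Fin.castLE_injective hd)
  · have h0 : ∀ i : Fin (finrank ℝ E), d ≤ (i : ℕ) → inner ℝ (b i) x = 0 := by
      intro i hi
      induction hx using Submodule.span_induction with
      | mem y hy =>
        obtain ⟨j, rfl⟩ := hy
        refine b.orthonormal.2 ?_
        intro h
        have : (i : ℕ) = j := by rw [h]; rfl
        have := j.2
        omega
      | zero => simp
      | add y z _ _ hy hz => rw [inner_add_right, hy, hz, add_zero]
      | smul a y _ hy => rw [inner_smul_right, hy, mul_zero]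
    refine abs_le_of_sq_le_sq' ?_ (norm_nonneg _) |>.2
    rw [norm_sq_apply_eq_sum_singularValues, mul_pow, ← b.sum_sq_inner_right x, Finset.mul_sum]
    refine Finset.sum_le_sum fun i _ => ?_
    by_cases hi : d ≤ (i : ℕ)
    · rw [← hb, h0 i hi]
      simp
    · exact mul_le_mul_of_nonneg_right
        (pow_le_pow_left₀ (T.singularValues_nonneg _) (T.singularValues_antitone (by omega)) 2)
        (sq_nonneg _)

end SingularValues

/-! ### Projections and the chordal metric -/

section Projection

variable {n d : ℕ}

/-- `X Xᵀ x` lies in the column span, and `Xᵀ` kills the residual `x - X Xᵀ x`; these two facts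
characterise the orthogonal projection. -/
lemma IsRep.proj_eq {X : Matrix (Fin n) (Fin d) ℝ} {U : Grass n d} (h : IsRep X U) :
    proj U = X * Xᵀ := by
  rw [proj, LinearEquiv.symm_apply_eq]
  ext1 x
  refine Submodule.eq_starProjection_of_mem_of_inner_eq_zero (v := toEuclideanLin (X * Xᵀ) x) ?_ ?_
  · rw [toEuclideanLin_mul_apply, ← h.2]
    have : toEuclideanLin X (toEuclideanLin Xᵀ x) =
        ∑ j, toEuclideanLin Xᵀ x j • colVec X j := by
      ext i
      simp [mulVec, dotProduct, mul_comm]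
    rw [this]
    exact Submodule.sum_mem _ fun j _ => Submodule.smul_mem _ _ (Submodule.subset_span ⟨j, rfl⟩)
  · intro w hw
    rw [← h.2] at hw
    induction hw using Submodule.span_induction with
    | mem y hy =>
      obtain ⟨j, rfl⟩ := hy
      have hj : colVec X j =
          toEuclideanLin X (EuclideanSpace.single j 1) := by
        ext i
        simp [mulVec, dotProduct, Pi.single_apply]
      have hx : toEuclideanLin Xᵀ (toEuclideanLin (X * Xᵀ) x) = toEuclideanLin Xᵀ x := by
        rw [← toEuclideanLin_mul_apply, ← Matrix.mul_assoc, h.1, Matrix.one_mul]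
      change inner ℝ (x - toEuclideanLin (X * Xᵀ) x) (colVec X j) = 0
      rw [hj, real_inner_comm, inner_toEuclideanLin, map_sub, hx, sub_self, inner_zero_right]
    | zero => simp
    | add y z _ _ hy hz => rw [inner_add_right, hy, hz, add_zero]
    | smul a y _ hy => rw [inner_smul_right, hy, mul_zero]

lemma exists_isRep (U : Grass n d) : ∃ X, IsRep X U := by
  have b := (stdOrthonormalBasis ℝ U.1).reindex (finCongr U.2)
  refine ⟨of fun i j => (b j : EuclideanSpace ℝ (Fin n)) i, ?_, ?_⟩
  · ext i j
    have h := orthonormal_iff_ite.1 b.orthonormal i j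
    rw [Submodule.coe_inner, PiLp.inner_apply] at h
    rw [one_apply, ← h]
    simp [mul_apply, mul_comm]
  · have h := congrArg (Submodule.map U.1.subtype) b.toBasis.span_eq
    rw [Submodule.map_span, Submodule.map_top, Submodule.range_subtype, ← Set.range_comp] at h
    conv_rhs => rw [← h]
    rw [colSpan]
    congr 2

lemma toEuclideanLin_proj (U : Grass n d) (x : EuclideanSpace ℝ (Fin n)) :
    toEuclideanLin (proj U) x = U.1.starProjection x := by
  rw [proj, LinearEquiv.apply_symm_apply]
  rfl

lemma toEuclideanLin_proj_mem (U : Grass n d) (x : EuclideanSpace ℝ (Fin n)) :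
    toEuclideanLin (proj U) x ∈ U.1 := by
  rw [toEuclideanLin_proj]
  exact Submodule.starProjection_apply_mem _ _

lemma toEuclideanLin_proj_of_mem {U : Grass n d} {x : EuclideanSpace ℝ (Fin n)} (hx : x ∈ U.1) :
    toEuclideanLin (proj U) x = x := by
  rw [toEuclideanLin_proj]
  exact Submodule.starProjection_eq_self_iff.2 hx

lemma proj_transpose (U : Grass n d) : (proj U)ᵀ = proj U := by
  obtain ⟨X, hX⟩ := exists_isRep U
  rw [hX.proj_eq, transpose_mul, transpose_transpose]

lemma proj_mul_self (U : Grass n d) : proj U * proj U = proj U := by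
  obtain ⟨X, hX⟩ := exists_isRep U
  rw [hX.proj_eq, Matrix.mul_assoc, ← Matrix.mul_assoc Xᵀ, hX.1, Matrix.one_mul]

lemma trace_proj (U : Grass n d) : trace (proj U) = d := by
  obtain ⟨X, hX⟩ := exists_isRep U
  rw [hX.proj_eq, trace_mul_comm, hX.1, trace_one, Fintype.card_fin]

lemma one_sub_proj_transpose (U : Grass n d) : (1 - proj U)ᵀ = 1 - proj U := by
  rw [transpose_sub, transpose_one, proj_transpose]

lemma one_sub_proj_mul_self (U : Grass n d) : (1 - proj U) * (1 - proj U) = 1 - proj U := by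
  simp [Matrix.mul_sub, Matrix.sub_mul, proj_mul_self]

lemma one_sub_proj_mul_proj (U : Grass n d) : (1 - proj U) * proj U = 0 := by
  rw [Matrix.sub_mul, Matrix.one_mul, proj_mul_self, sub_self]

lemma opLe_proj (U : Grass n d) : OpLe (proj U) 1 :=
  opLe_one_of_projection (proj_transpose U) (proj_mul_self U)

lemma opLe_one_sub_proj (U : Grass n d) : OpLe (1 - proj U) 1 :=
  opLe_one_of_projection (one_sub_proj_transpose U) (one_sub_proj_mul_self U)

lemma chordal_eq_frobNorm (U V : Grass n d) :
    chordal U V = frobNorm ((1 - proj U) * proj V) := by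
  have h : trace ((1 - proj U) * proj V) = frobNorm ((1 - proj U) * proj V) ^ 2 := by
    rw [frobNorm_sq_eq_trace_of_projection (one_sub_proj_transpose U) (one_sub_proj_mul_self U),
      proj_transpose, trace_mul_comm (proj V * _), ← Matrix.mul_assoc, proj_mul_self,
      trace_mul_comm]
  rw [chordal, h, Real.sqrt_sq (frobNorm_nonneg _)]

lemma chordal_sq (U V : Grass n d) :
    chordal U V ^ 2 = d - trace (proj U * proj V) := by
  rw [chordal_eq_frobNorm,
    frobNorm_sq_eq_trace_of_projection (one_sub_proj_transpose U) (one_sub_proj_mul_self U),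
    trace_mul_comm, proj_transpose, ← Matrix.mul_assoc, proj_mul_self, Matrix.mul_sub, trace_sub,
    Matrix.mul_one, trace_proj, trace_mul_comm]

lemma chordal_nonneg (U V : Grass n d) : 0 ≤ chordal U V := Real.sqrt_nonneg _

lemma chordal_comm (U V : Grass n d) : chordal U V = chordal V U := by
  refine (sq_eq_sq₀ (chordal_nonneg _ _) (chordal_nonneg _ _)).1 ?_
  rw [chordal_sq, chordal_sq, trace_mul_comm]

/-- This embeds the Grassmannian isometrically, up to scale, into matrices with the Frobenius norm;
the triangle inequality is inherited from there. -/
lemma sqrt_two_mul_chordal (U V : Grass n d) :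
    Real.sqrt 2 * chordal U V = frobNorm (proj U - proj V) := by
  refine (sq_eq_sq₀ (mul_nonneg (Real.sqrt_nonneg _) (chordal_nonneg _ _))
    (frobNorm_nonneg _)).1 ?_
  rw [mul_pow, Real.sq_sqrt zero_le_two, chordal_sq, frobNorm_sq_eq_trace, transpose_sub,
    proj_transpose, proj_transpose, Matrix.sub_mul, Matrix.mul_sub, Matrix.mul_sub, proj_mul_self,
    proj_mul_self, trace_sub, trace_sub, trace_sub, trace_proj, trace_proj,
    trace_mul_comm (proj V)]
  ring

lemma chordal_triangle (U V W : Grass n d) : chordal U W ≤ chordal U V + chordal V W := by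
  have h := frobNorm_add_le (proj U - proj V) (proj V - proj W)
  rw [sub_add_sub_cancel, ← sqrt_two_mul_chordal, ← sqrt_two_mul_chordal, ← sqrt_two_mul_chordal,
    ← mul_add] at h
  exact le_of_mul_le_mul_left h (by positivity)

lemma norm_one_sub_proj_le {U V : Grass n d} {x : EuclideanSpace ℝ (Fin n)} (hx : x ∈ V.1) :
    ‖toEuclideanLin (1 - proj U) x‖ ≤ chordal U V * ‖x‖ := by
  rw [chordal_eq_frobNorm]
  conv_lhs => rw [← toEuclideanLin_proj_of_mem hx, ← toEuclideanLin_mul_apply]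
  exact (opLe_frobNorm _).2 x

/-- The projection onto `V` shrinks vectors of a nearby subspace `U` only a little. -/
lemma sqrt_mul_norm_le_norm_proj {U V : Grass n d} {r : ℝ} (hr : chordal V U ≤ r) (hr1 : r < 1)
    {x : EuclideanSpace ℝ (Fin n)} (hx : x ∈ U.1) :
    Real.sqrt (1 - r ^ 2) * ‖x‖ ≤ ‖toEuclideanLin (proj V) x‖ := by
  have h0 := chordal_nonneg V U
  refine abs_le_of_sq_le_sq' ?_ (norm_nonneg _) |>.2
  rw [mul_pow, Real.sq_sqrt (by nlinarith)]
  have h1 := norm_one_sub_proj_le (U := V) hx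
  have h2 : toEuclideanLin (1 - proj V) x = x - toEuclideanLin (proj V) x := by
    simp [map_sub, toLpLin_one]
  have h3 : inner ℝ x (toEuclideanLin (proj V) x) = ‖toEuclideanLin (proj V) x‖ ^ 2 := by
    rw [← real_inner_self_eq_norm_sq, inner_toEuclideanLin, proj_transpose,
      ← toEuclideanLin_mul_apply, proj_mul_self]
  have h4 : ‖toEuclideanLin (1 - proj V) x‖ ^ 2 ≤ r ^ 2 * ‖x‖ ^ 2 := by
    rw [← mul_pow]
    exact pow_le_pow_left₀ (norm_nonneg _)
      (h1.trans (mul_le_mul_of_nonneg_right hr (norm_nonneg _))) 2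
  -- Pythagoras for `x = P_V x + (x - P_V x)`.
  rw [h2, norm_sub_sq_real, h3] at h4
  linarith

lemma colVec_proj_mul_mem {k : ℕ} (U : Grass n d) (A : Matrix (Fin n) (Fin k) ℝ) (j : Fin k) :
    colVec (proj U * A) j ∈ U.1 := by
  rw [colVec_mul]
  exact toEuclideanLin_proj_mem _ _

/-- If `d` singular values of `P_U W` are at least `s`, then `Wᵀ` expands vectors of `U` by `s`. -/
lemma mul_norm_le_of_le_sigma {T : ℕ} {U : Grass n d} {W : Matrix (Fin n) (Fin T) ℝ} {s : ℝ}
    (hs : 0 < s) (hdT : d ≤ T) (h : s ≤ sigma d (proj U * W)) {x : EuclideanSpace ℝ (Fin n)}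
    (hx : x ∈ U.1) : s * ‖x‖ ≤ ‖toEuclideanLin (proj U * W)ᵀ x‖ := by
  set A := proj U * W with hA
  obtain ⟨M, hM, hM'⟩ := exists_submodule_singularValues_le (toEuclideanLin A) (d := d)
    (by simpa using hdT)
  have hM'' : ∀ v ∈ M, s * ‖v‖ ≤ ‖toEuclideanLin A v‖ := fun v hv =>
    (mul_le_mul_of_nonneg_right h (norm_nonneg v)).trans (hM' v hv)
  -- `A` is injective on `M` and maps into `U`; as both have dimension `d`, its image is all of `U`.
  have hmap : M.map (toEuclideanLin A) = U.1 := by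
    refine Submodule.eq_of_le_of_finrank_eq ?_ ?_
    · rintro _ ⟨v, -, rfl⟩
      rw [hA, toEuclideanLin_mul_apply]
      exact toEuclideanLin_proj_mem _ _
    · have hinj : Function.Injective ((toEuclideanLin A).domRestrict M) := by
        rw [← LinearMap.ker_eq_bot, LinearMap.ker_eq_bot']
        intro v hv
        have h1 := hM'' v v.2
        rw [LinearMap.domRestrict_apply] at hv
        rw [hv, norm_zero] at h1
        have h2 : ‖(v : EuclideanSpace ℝ (Fin T))‖ ≤ 0 :=
          nonpos_of_mul_nonpos_right h1 hs
        exact Subtype.ext (norm_le_zero_iff.1 h2)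
      rw [← LinearMap.range_domRestrict, LinearMap.finrank_range_of_inj hinj, hM, U.2]
  rw [← hmap] at hx
  obtain ⟨v, hv, rfl⟩ := hx
  set y := toEuclideanLin A v with hy
  -- Duality: with `y = A v`, `‖y‖² = ⟪Aᵀ y, v⟫` and `s ‖v‖ ≤ ‖y‖`, so the lower bound for `A` on
  -- `M` passes to `Aᵀ` on `U`.
  rcases (norm_nonneg y).eq_or_lt with h0 | h0
  · rw [← h0, mul_zero]
    exact norm_nonneg _
  · refine le_of_mul_le_mul_right ?_ h0
    calc s * ‖y‖ * ‖y‖ = s * inner ℝ y y := by rw [real_inner_self_eq_norm_mul_norm, mul_assoc]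
      _ = s * inner ℝ (toEuclideanLin Aᵀ y) v := by
          conv_lhs => rw [hy, inner_toEuclideanLin, real_inner_comm]
      _ ≤ s * (‖toEuclideanLin Aᵀ y‖ * ‖v‖) :=
          mul_le_mul_of_nonneg_left (real_inner_le_norm _ _) hs.le
      _ = ‖toEuclideanLin Aᵀ y‖ * (s * ‖v‖) := by ring
      _ ≤ ‖toEuclideanLin Aᵀ y‖ * ‖y‖ :=
          mul_le_mul_of_nonneg_left (hM'' v hv) (norm_nonneg _)

lemma opLe_of_sigma_one_le {m k : ℕ} {A : Matrix (Fin m) (Fin k) ℝ} {s : ℝ} (h : sigma 1 A ≤ s) :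
    OpLe A s :=
  ⟨((toEuclideanLin A).singularValues_nonneg 0).trans h, fun x =>
    (norm_apply_le_singularValues_zero _ x).trans (mul_le_mul_of_nonneg_right h (norm_nonneg x))⟩

end Projection

/-! ### Riemannian gradients: uniqueness and explicit formulas -/

section Gradient

variable {n d : ℕ}

/-- Rotating the `j`-th column of an orthonormal representation towards a unit normal vector. -/
lemma isometry_updateCol {X : Matrix (Fin n) (Fin d) ℝ} (hX : Xᵀ * X = 1) {v : Fin n → ℝ}
    (hv : Xᵀ *ᵥ v = 0) (hv1 : v ⬝ᵥ v = 1) (j : Fin d) (τ : ℝ) :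
    (X.updateCol j (Real.cos τ • X.col j + Real.sin τ • v))ᵀ *
      X.updateCol j (Real.cos τ • X.col j + Real.sin τ • v) = 1 := by
  have hXX : ∀ a b, X.col a ⬝ᵥ X.col b = if a = b then 1 else 0 := fun a b => by
    rw [← one_apply, ← hX]
    rfl
  have hXv : ∀ a, X.col a ⬝ᵥ v = 0 := fun a => congrFun hv a
  set Y := X.updateCol j (Real.cos τ • X.col j + Real.sin τ • v) with hY
  have hYj : Y.col j = Real.cos τ • X.col j + Real.sin τ • v := by
    ext i
    simp [hY]
  have hYb : ∀ b, b ≠ j → Y.col b = X.col b := fun b hb => by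
    ext i
    simp [hY, hb]
  ext a b
  change Y.col a ⬝ᵥ Y.col b = _
  rw [one_apply]
  by_cases ha : a = j <;> by_cases hb : b = j
  · subst ha hb
    simp only [hYj, if_true, dotProduct_add, add_dotProduct, dotProduct_smul, smul_dotProduct, hXX,
      hXv, dotProduct_comm v, hv1, smul_eq_mul]
    nlinarith [Real.sin_sq_add_cos_sq τ]
  · subst ha
    simp [hYj, hYb b hb, Ne.symm hb, add_dotProduct, smul_dotProduct, hXX, dotProduct_comm v, hXv]
  · subst hb
    simp [hYj, hYb a ha, ha, dotProduct_add, dotProduct_smul, hXX, hXv]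
  · simp [hYb a ha, hYb b hb, hXX]

lemma exists_isRep_of_isometry {X : Matrix (Fin n) (Fin d) ℝ} (hX : Xᵀ * X = 1) :
    ∃ U : Grass n d, IsRep X U := by
  refine ⟨⟨colSpan X, ?_⟩, hX, rfl⟩
  have h : colSpan X = Submodule.span ℝ (Set.range (colVec X)) := rfl
  have ho : Orthonormal ℝ (colVec X) := by
    rw [orthonormal_iff_ite]
    intro i j
    rw [← one_apply, ← hX, PiLp.inner_apply]
    simp [mul_apply, mul_comm]
  rw [h, finrank_span_eq_card ho.linearIndependent, Fintype.card_fin]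

attribute [local instance] Matrix.normedAddCommGroup Matrix.normedSpace

/-- The differential of an extension is determined on normal vectors by the values on
orthonormal representations. -/
lemma hasFDerivAt_unique_of_normal {f₁ f₂ : Matrix (Fin n) (Fin d) ℝ → ℝ}
    {L₁ L₂ : Matrix (Fin n) (Fin d) ℝ →L[ℝ] ℝ} {X : Matrix (Fin n) (Fin d) ℝ} (hX : Xᵀ * X = 1)
    (h : ∀ Y : Matrix (Fin n) (Fin d) ℝ, Yᵀ * Y = 1 → f₁ Y = f₂ Y)
    (h₁ : HasFDerivAt f₁ L₁ X) (h₂ : HasFDerivAt f₂ L₂ X) {v : Fin n → ℝ}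
    (hv : Xᵀ *ᵥ v = 0) (hv1 : v ⬝ᵥ v = 1) (j : Fin d) :
    L₁ (updateCol 0 j v) = L₂ (updateCol 0 j v) := by
  -- A curve of orthonormal matrices through `X` whose velocity at `0` is `v` placed in column `j`.
  -- Both functions agree along it, so the chain rule equates the differentials.
  set γ : ℝ → Matrix (Fin n) (Fin d) ℝ :=
    fun τ => X.updateCol j (Real.cos τ • X.col j + Real.sin τ • v) with hγ
  have hγ0 : γ 0 = X := by
    ext a b
    simp only [hγ, updateCol_apply]
    split_ifs with hb
    · simp [hb]
    · rfl
  have hd : HasDerivAt γ (updateCol 0 j v) 0 := by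
    refine hasDerivAt_pi.2 fun a => hasDerivAt_pi.2 fun b => ?_
    simp only [hγ, updateCol_apply]
    split_ifs with hb
    · have h1 := ((Real.hasDerivAt_cos 0).mul_const (X a j)).add
        ((Real.hasDerivAt_sin 0).mul_const (v a))
      refine (h1.congr_deriv ?_ : HasDerivAt _ _ _)
      simp
    · exact hasDerivAt_const _ _
  rw [← hγ0] at h₁ h₂
  have e₁ := h₁.comp_hasDerivAt 0 hd
  have e₂ := h₂.comp_hasDerivAt 0 hd
  have : f₁ ∘ γ = f₂ ∘ γ := funext fun τ => h _ (isometry_updateCol hX hv hv1 j τ)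
  rw [this] at e₁
  exact e₁.unique e₂

/-- Two extensions agree on orthonormal matrices, hence have the same derivative in every direction
normal to `X`. The factor `I - X Xᵀ` discards the remaining directions. -/
lemma HasRiemannianGradAt.unique {f : Grass n d → ℝ} {X G₁ G₂ : Matrix (Fin n) (Fin d) ℝ}
    (hX : Xᵀ * X = 1) (h₁ : HasRiemannianGradAt f X G₁) (h₂ : HasRiemannianGradAt f X G₂) :
    G₁ = G₂ := by
  obtain ⟨f₁, L₁, g₁, hf₁, hL₁, hg₁, rfl⟩ := h₁
  obtain ⟨f₂, L₂, g₂, hf₂, hL₂, hg₂, rfl⟩ := h₂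
  have hf : ∀ Y : Matrix (Fin n) (Fin d) ℝ, Yᵀ * Y = 1 → f₁ Y = f₂ Y := fun Y hY => by
    obtain ⟨V, hV⟩ := exists_isRep_of_isometry hY
    rw [hf₁ V Y hV, hf₂ V Y hV]
  have key : ∀ (v : Fin n → ℝ), Xᵀ *ᵥ v = 0 → ∀ j, v ⬝ᵥ (g₁ - g₂).col j = 0 := by
    intro v hv j
    by_cases hv0 : v ⬝ᵥ v = 0
    · rw [dotProduct_self_eq_zero.1 hv0, zero_dotProduct]
    have hpos : 0 < v ⬝ᵥ v := lt_of_le_of_ne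
      (Finset.sum_nonneg fun i _ => mul_self_nonneg (v i)) (Ne.symm hv0)
    have hs : Real.sqrt (v ⬝ᵥ v) ≠ 0 := (Real.sqrt_pos.2 hpos).ne'
    have h := hasFDerivAt_unique_of_normal hX hf hL₁ hL₂ (v := (Real.sqrt (v ⬝ᵥ v))⁻¹ • v)
      (by rw [mulVec_smul, hv, smul_zero])
      (by
        rw [smul_dotProduct, dotProduct_smul, smul_eq_mul, smul_eq_mul, ← mul_assoc, ← mul_inv,
          Real.mul_self_sqrt hpos.le, inv_mul_cancel₀ hv0]) j
    have ht : ∀ g : Matrix (Fin n) (Fin d) ℝ,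
        trace (gᵀ * updateCol 0 j ((Real.sqrt (v ⬝ᵥ v))⁻¹ • v)) =
          (Real.sqrt (v ⬝ᵥ v))⁻¹ * (v ⬝ᵥ g.col j) := fun g => by
      rw [trace, Finset.sum_eq_single j]
      · simp [mul_apply, dotProduct, Finset.mul_sum, mul_left_comm, mul_comm]
        exact Finset.sum_congr rfl fun i _ => by ring
      · intro b _ hb
        simp [mul_apply, hb]
      · simp
    rw [hg₁, hg₂, ht, ht] at h
    have h' := mul_left_cancel₀ (inv_ne_zero hs) h
    have : (g₁ - g₂).col j = g₁.col j - g₂.col j := rfl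
    rw [this, dotProduct_sub, h', sub_self]
  rw [← sub_eq_zero, ← Matrix.mul_sub]
  have hP : Xᵀ * (1 - X * Xᵀ) = 0 := by
    rw [Matrix.mul_sub, ← Matrix.mul_assoc, hX, Matrix.mul_one, Matrix.one_mul, sub_self]
  -- The columns of `A` are themselves normal to `X`, so `key` applies to them and yields `Aᵀ A = Aᵀ
  -- (g₁ - g₂) = 0`.
  set A := (1 - X * Xᵀ) * (g₁ - g₂) with hA
  have hXA : Xᵀ * A = 0 := by rw [hA, ← Matrix.mul_assoc, hP, Matrix.zero_mul]
  have hXA' : ∀ j, Xᵀ *ᵥ A.col j = 0 := fun j => funext fun i => congrFun (congrFun hXA i) j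
  have hAA : Aᵀ * A = Aᵀ * (g₁ - g₂) := by
    have : A = (g₁ - g₂) - X * (Xᵀ * (g₁ - g₂)) := by
      rw [hA, Matrix.sub_mul, Matrix.one_mul, Matrix.mul_assoc]
    have h0 : Aᵀ * X = 0 := by
      rw [← transpose_transpose (Aᵀ * X), transpose_mul, transpose_transpose, hXA, transpose_zero]
    conv_lhs => rw [this, Matrix.mul_sub, ← this, ← Matrix.mul_assoc, h0, Matrix.zero_mul, sub_zero]
  have hz : Aᵀ * A = 0 := by
    ext i j
    rw [hAA]
    exact key _ (hXA' i) j
  have := frobNorm_sq_eq_trace A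
  rw [hz, trace_zero, frobNorm_sq] at this
  ext i j
  have h1 := (Finset.sum_eq_zero_iff_of_nonneg
    (fun _ _ => Finset.sum_nonneg fun _ _ => sq_nonneg _)).1 this i (Finset.mem_univ i)
  have h2 := (Finset.sum_eq_zero_iff_of_nonneg (fun _ _ => sq_nonneg _)).1 h1 j (Finset.mem_univ j)
  simpa using h2

/-- The Riemannian gradient of a function given by a quadratic form in the representation. -/
lemma hasRiemannianGradAt_of_quadratic {f : Grass n d → ℝ} {M : Matrix (Fin n) (Fin n) ℝ} {a : ℝ}
    (hM : Mᵀ = M) (hf : ∀ V Y, IsRep Y V → f V = a - trace (Yᵀ * M * Y))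
    (X : Matrix (Fin n) (Fin d) ℝ) :
    HasRiemannianGradAt f X ((1 - X * Xᵀ) * (-(2 : ℝ) • (M * X))) := by
  let B : Matrix (Fin n) (Fin d) ℝ →ₗ[ℝ] ℝ :=
    { toFun := fun H => trace ((-(2 : ℝ) • (M * X))ᵀ * H)
      map_add' := fun H H' => by rw [Matrix.mul_add, trace_add]
      map_smul' := fun b H => by simp [Matrix.mul_smul] }
  refine ⟨fun Y => a - trace (Yᵀ * M * Y), LinearMap.toContinuousLinearMap B,
    -(2 : ℝ) • (M * X), fun V Y hY => (hf V Y hY).symm, ?_, fun H => rfl, rfl⟩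
  -- The quadratic term is a bilinear form on the diagonal; the two terms of the product rule
  -- coincide because `M` is symmetric.
  let Q : Matrix (Fin n) (Fin d) ℝ →ₗ[ℝ] Matrix (Fin n) (Fin d) ℝ →ₗ[ℝ] ℝ :=
    LinearMap.mk₂ ℝ (fun Y Z => trace (Yᵀ * M * Z))
      (fun Y Y' Z => by rw [transpose_add, Matrix.add_mul, Matrix.add_mul, trace_add])
      (fun b Y Z => by simp)
      (fun Y Z Z' => by rw [Matrix.mul_add, trace_add])
      (fun b Y Z => by simp)
  have hQ := (LinearMap.toContinuousBilinearMap Q).hasFDerivAt_of_bilinear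
    (hasFDerivAt_id X) (hasFDerivAt_id X)
  refine (hQ.const_sub a).congr_fderiv ?_
  refine ContinuousLinearMap.ext fun H => ?_
  change -(trace (Xᵀ * M * H) + trace (Hᵀ * M * X)) = trace ((-(2 : ℝ) • (M * X))ᵀ * H)
  have h : trace (Hᵀ * M * X) = trace (Xᵀ * M * H) := by
    rw [← trace_transpose]
    simp [hM, Matrix.mul_assoc]
  rw [h, transpose_smul, transpose_mul, hM, smul_mul, trace_smul, smul_eq_mul]
  ring

lemma hasRiemannianGradAt_chordal_sq (U : Grass n d) (X : Matrix (Fin n) (Fin d) ℝ) :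
    HasRiemannianGradAt (fun V => chordal V U ^ 2) X
      ((1 - X * Xᵀ) * (-(2 : ℝ) • (proj U * X))) := by
  refine hasRiemannianGradAt_of_quadratic (a := d) (proj_transpose U) (fun V Y hY => ?_) X
  rw [chordal_sq, hY.proj_eq, Matrix.mul_assoc, trace_mul_comm, Matrix.mul_assoc, trace_mul_comm,
    Matrix.mul_assoc]

lemma hasRiemannianGradAt_cost {T : ℕ} (W : Matrix (Fin n) (Fin T) ℝ)
    (X : Matrix (Fin n) (Fin d) ℝ) :
    HasRiemannianGradAt (cost W) X ((1 - X * Xᵀ) * (-(2 : ℝ) • (W * Wᵀ * X))) := by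
  refine hasRiemannianGradAt_of_quadratic (a := trace (Wᵀ * W))
    (by rw [transpose_mul, transpose_transpose]) (fun V Y hY => ?_) X
  rw [cost, frobNorm_sq_eq_trace_of_projection (one_sub_proj_transpose V)
    (one_sub_proj_mul_self V), Matrix.mul_sub, Matrix.sub_mul, trace_sub, Matrix.mul_one,
    hY.proj_eq]
  congr 1
  rw [← Matrix.mul_assoc, Matrix.mul_assoc, trace_mul_comm]
  simp only [Matrix.mul_assoc]

end Gradient

/-! ### Second-order bound along the exponential map -/

section ExpStep

variable {n d : ℕ}

/-- This is the discriminant condition for the quadratic form behind `norm_sq_rotation_le`. The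
bound `3/2` is a convenient number below `π/2`, where the cosine is positive. -/
lemma sq_sin_sub_mul_cos_le {s : ℝ} (h0 : 0 ≤ s) (h1 : s ≤ 3 / 2) :
    (Real.sin s - s * Real.cos s) ^ 2 ≤ s ^ 2 * Real.sin s ^ 2 := by
  have hpi : s < Real.pi / 2 := by linarith [Real.pi_gt_three]
  have hcos : 0 < Real.cos s := Real.cos_pos_of_mem_Ioo ⟨by linarith, hpi⟩
  have hsin : 0 ≤ Real.sin s := Real.sin_nonneg_of_nonneg_of_le_pi h0 (by linarith)
  have hlow : s * Real.cos s ≤ Real.sin s := by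
    have := Real.le_tan h0 hpi
    rwa [Real.tan_eq_sin_div_cos, le_div_iff₀ hcos] at this
  have hup : Real.sin s - s * Real.cos s ≤ s * Real.sin s := by
    -- For `s ≥ 1` the cosine term can be dropped; for `s ≤ 1` the bounds `sin s ≤ s` and `cos s ≥ 1
    -- - s²/2` suffice.
    rcases le_total 1 s with hs | hs
    · nlinarith
    · have e1 := Real.sin_le h0
      have e2 := Real.one_sub_sq_div_two_le_cos (x := s)
      have e3 := mul_le_mul_of_nonneg_left e2 h0
      have e4 := mul_le_mul_of_nonneg_left e1 (sub_nonneg.2 hs)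
      nlinarith [mul_nonneg (sq_nonneg s) (by linarith : 0 ≤ 2 - s)]
  rw [← mul_pow]
  exact pow_le_pow_left₀ (sub_nonneg.2 hlow) hup 2

/-- Second order upper bound for the squared norm along a rotation. -/
lemma norm_sq_rotation_le {E : Type*} [NormedAddCommGroup E] [InnerProductSpace ℝ E] (x y : E)
    {s : ℝ} (h0 : 0 ≤ s) (h1 : s ≤ 3 / 2) :
    ‖Real.cos s • x + Real.sin s • y‖ ^ 2 ≤
      ‖x‖ ^ 2 + 2 * (s * inner ℝ x y) + 2 * (s ^ 2 * ‖y‖ ^ 2) := by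
  rcases h0.eq_or_lt with rfl | hpos
  · simp
  have hA : 0 < Real.sin s ^ 2 := by
    have : 0 < Real.sin s := Real.sin_pos_of_pos_of_lt_pi hpos (by linarith [Real.pi_gt_three])
    positivity
  have hq := mul_nonneg (sub_nonneg.2 (sq_sin_sub_mul_cos_le h0 h1)) (sq_nonneg ‖y‖)
  -- Completing the square: multiplied by `sin² s`, the gap between the two sides is this square
  -- plus the discriminant times `‖y‖²`.
  have hn := sq_nonneg ‖(Real.sin s ^ 2) • x + (s - Real.sin s * Real.cos s) • y‖
  rw [norm_add_sq_real, norm_smul, norm_smul, inner_smul_left, inner_smul_right, mul_pow, mul_pow,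
    Real.norm_eq_abs, Real.norm_eq_abs, sq_abs, sq_abs] at hn ⊢
  simp only [conj_trivial] at hn ⊢
  have hc : Real.cos s ^ 2 = 1 - Real.sin s ^ 2 := Real.cos_sq' s
  rw [← sub_nonneg]
  refine nonneg_of_mul_nonneg_right ?_ hA
  have key : Real.sin s ^ 2 * (‖x‖ ^ 2 + 2 * (s * inner ℝ x y) + 2 * (s ^ 2 * ‖y‖ ^ 2) -
      (Real.cos s ^ 2 * ‖x‖ ^ 2 + 2 * (Real.cos s * (Real.sin s * inner ℝ x y)) +
        Real.sin s ^ 2 * ‖y‖ ^ 2)) =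
      ((Real.sin s ^ 2) ^ 2 * ‖x‖ ^ 2 + 2 * (Real.sin s ^ 2 *
        ((s - Real.sin s * Real.cos s) * inner ℝ x y)) +
        (s - Real.sin s * Real.cos s) ^ 2 * ‖y‖ ^ 2) +
      (s ^ 2 * Real.sin s ^ 2 - (Real.sin s - s * Real.cos s) ^ 2) * ‖y‖ ^ 2 := by
    linear_combination (-(Real.sin s ^ 2 * ‖x‖ ^ 2)
      + (s ^ 2 - Real.sin s ^ 2) * ‖y‖ ^ 2) * hc
  rw [key]
  exact add_nonneg hn hq

lemma frobNorm_mul_transpose_of_isometry {m k l : ℕ} {X : Matrix (Fin m) (Fin k) ℝ}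
    (hX : Xᵀ * X = 1) (A : Matrix (Fin l) (Fin k) ℝ) : frobNorm (A * Xᵀ) = frobNorm A := by
  refine (sq_eq_sq₀ (frobNorm_nonneg _) (frobNorm_nonneg _)).1 ?_
  rw [frobNorm_sq_eq_trace, frobNorm_sq_eq_trace, transpose_mul, transpose_transpose,
    trace_mul_comm, Matrix.mul_assoc, ← Matrix.mul_assoc Xᵀ, hX, Matrix.one_mul, trace_mul_comm]

lemma chordal_eq_frobNorm_of_isRep {U V : Grass n d} {X : Matrix (Fin n) (Fin d) ℝ}
    (hX : IsRep X V) : chordal U V = frobNorm ((1 - proj U) * X) := by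
  rw [chordal_eq_frobNorm, hX.proj_eq, ← Matrix.mul_assoc, frobNorm_mul_transpose_of_isometry hX.1]

/-- The explicit formula for the exponential map yields an orthonormal representation. -/
lemma IsCompactSVD.isometry_exp {X V Q₁ : Matrix (Fin n) (Fin d) ℝ} {s : Fin d → ℝ}
    {Q₂ : Matrix (Fin d) (Fin d) ℝ} (h : IsCompactSVD V Q₁ s Q₂) (hX : Xᵀ * X = 1)
    (hV : Xᵀ * V = 0) :
    (X * Q₂ * diagonal (fun i => Real.cos (s i)) + Q₁ * diagonal (fun i => Real.sin (s i)))ᵀ *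
      (X * Q₂ * diagonal (fun i => Real.cos (s i)) + Q₁ * diagonal (fun i => Real.sin (s i)))
      = 1 := by
  obtain ⟨-, hQ, hQ₁, hVe⟩ := h
  -- Normality of `V` makes the columns of `Q₁` with `s j ≠ 0` orthogonal to `X`. The other columns
  -- are arbitrary, but are always multiplied by `sin 0 = 0`.
  have hXQ : ∀ i j, s j ≠ 0 → (Xᵀ * Q₁) i j = 0 := by
    intro i j hj
    have h1 : Xᵀ * Q₁ * diagonal s = 0 := by
      have : Xᵀ * V * Q₂ = Xᵀ * Q₁ * diagonal s := by
        rw [hVe]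
        simp only [Matrix.mul_assoc]
        rw [hQ, Matrix.mul_one]
      rw [← this, hV, Matrix.zero_mul]
    have h2 := congrFun (congrFun h1 i) j
    rw [mul_diagonal, Matrix.zero_apply] at h2
    exact (mul_eq_zero.1 h2).resolve_right hj
  set C := diagonal fun i => Real.cos (s i) with hC
  set S := diagonal fun i => Real.sin (s i) with hS
  have hcross : Xᵀ * Q₁ * S = 0 := by
    ext i j
    rw [hS, mul_diagonal, Matrix.zero_apply]
    by_cases hj : s j = 0
    · rw [hj, Real.sin_zero, mul_zero]
    · rw [hXQ i j hj, zero_mul]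
  have h1 : (X * Q₂ * C)ᵀ * (Q₁ * S) = 0 := by
    have : (X * Q₂ * C)ᵀ * (Q₁ * S) = (Q₂ * C)ᵀ * (Xᵀ * Q₁ * S) := by
      simp only [transpose_mul, Matrix.mul_assoc]
    rw [this, hcross, Matrix.mul_zero]
  have h2 : (Q₁ * S)ᵀ * (X * Q₂ * C) = 0 := by
    rw [← transpose_transpose ((Q₁ * S)ᵀ * (X * Q₂ * C)), transpose_mul, transpose_transpose, h1,
      transpose_zero]
  have h3 : (X * Q₂ * C)ᵀ * (X * Q₂ * C) = C * C := by
    have : (X * Q₂ * C)ᵀ * (X * Q₂ * C) = C * (Q₂ᵀ * ((Xᵀ * X) * Q₂)) * C := by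
      simp only [transpose_mul, Matrix.mul_assoc, hC, diagonal_transpose]
    rw [this, hX, Matrix.one_mul, hQ, Matrix.mul_one]
  have h4 : (Q₁ * S)ᵀ * (Q₁ * S) = S * S := by
    have : (Q₁ * S)ᵀ * (Q₁ * S) = S * (Q₁ᵀ * Q₁) * S := by
      simp only [transpose_mul, Matrix.mul_assoc, hS, diagonal_transpose]
    rw [this]
    ext i j
    rw [hS, mul_diagonal, diagonal_mul, diagonal_mul_diagonal, diagonal_apply]
    by_cases hi : s i = 0
    · simp [hi]
    by_cases hj : s j = 0
    · simp only [hj, Real.sin_zero, mul_zero]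
      split_ifs with hij
      · rw [hij, hj, Real.sin_zero, mul_zero]
      · rfl
    rw [hQ₁ i j hi hj]
    split_ifs with hij
    · rw [hij, mul_one]
    · rw [mul_zero, zero_mul]
  rw [transpose_add, Matrix.add_mul, Matrix.mul_add, Matrix.mul_add, h1, h2, h3, h4, add_zero,
    zero_add, hC, hS, diagonal_mul_diagonal, diagonal_mul_diagonal, diagonal_add, ← diagonal_one]
  congr 1
  ext i
  have := Real.sin_sq_add_cos_sq (s i)
  nlinarith

/-- The squared chordal distance to a fixed point after an exponential step: second order upper
bound with the curvature term restricted to the normal part of the tangent vector. -/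
lemma IsExp.chordal_sq_le {S U U' : Grass n d} {X V : Matrix (Fin n) (Fin d) ℝ} (hX : IsRep X U)
    (hV : Xᵀ * V = 0) (hV1 : frobNorm V ≤ 3 / 2) (h : IsExp X V U') :
    chordal S U' ^ 2 ≤ chordal S U ^ 2 + 2 * trace (((1 - proj S) * X)ᵀ * ((1 - proj S) * V))
      + 2 * frobNorm ((1 - proj S) * V) ^ 2 := by
  obtain ⟨Q₁, s, Q₂, hsvd, hU'⟩ := h
  have hZ := hsvd.isometry_exp hX.1 hV
  obtain ⟨hs, hQ, hQ₁, hVe⟩ := hsvd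
  have hQ' : Q₂ * Q₂ᵀ = 1 := mul_eq_one_comm.1 hQ
  have hVQ : V * Q₂ = Q₁ * diagonal s := by
    rw [hVe, Matrix.mul_assoc, hQ, Matrix.mul_one]
  have hright : ∀ {k : ℕ} (A : Matrix (Fin k) (Fin d) ℝ), frobNorm (A * Q₂) = frobNorm A := by
    intro k A
    have := frobNorm_mul_transpose_of_isometry (X := Q₂ᵀ) (by rw [transpose_transpose, hQ']) A
    rwa [transpose_transpose] at this
  set Z := X * Q₂ * diagonal (fun i => Real.cos (s i)) + Q₁ * diagonal (fun i => Real.sin (s i))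
    with hZdef
  have hrep : IsRep (Z * Q₂ᵀ) U' := by
    refine ⟨?_, ?_⟩
    · rw [transpose_mul, transpose_transpose, Matrix.mul_assoc, ← Matrix.mul_assoc Zᵀ, hZ,
        Matrix.one_mul, hQ']
    · rw [hU', hZdef, Matrix.add_mul]
  set P := 1 - proj S
  -- In these columns the exponential step is a separate rotation by the angle `s j` for each `j`.
  set x := fun j => colVec (P * X * Q₂) j with hx
  set y := fun j => colVec (P * Q₁) j with hy
  have hZc : ∀ j, colVec (P * Z) j = Real.cos (s j) • x j + Real.sin (s j) • y j := by
    intro j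
    have : P * Z = P * X * Q₂ * diagonal (fun i => Real.cos (s i)) +
        P * Q₁ * diagonal (fun i => Real.sin (s i)) := by
      rw [hZdef, Matrix.mul_add]
      simp only [Matrix.mul_assoc]
    ext i
    rw [this]
    simp [hx, hy, mul_comm]
  have hVc : ∀ j, colVec (P * V * Q₂) j = s j • y j := by
    intro j
    have : P * V * Q₂ = P * Q₁ * diagonal s := by
      rw [Matrix.mul_assoc, hVQ, Matrix.mul_assoc]
    ext i
    rw [this]
    simp [hy, mul_comm]
  -- A nonzero singular value is the length of a column of `V * Q₂`, hence at most `‖V‖_F`.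
  have hs1 : ∀ j, s j ≤ 3 / 2 := by
    intro j
    by_cases hj : s j = 0
    · rw [hj]
      norm_num
    · have hq : ‖colVec Q₁ j‖ ^ 2 = 1 := by
        have := hQ₁ j j hj hj
        rw [if_pos rfl] at this
        rw [← this, EuclideanSpace.norm_sq_eq]
        simp [mul_apply, sq]
      have hq1 : ‖colVec Q₁ j‖ = 1 := by
        rwa [pow_eq_one_iff_of_nonneg (norm_nonneg _) two_ne_zero] at hq
      have hc : colVec (V * Q₂) j = s j • colVec Q₁ j := by
        ext i
        rw [hVQ]
        simp [mul_comm]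
      have := norm_colVec_le (V * Q₂) j
      rw [hc, norm_smul, hq1, mul_one, hright, Real.norm_of_nonneg (hs j)] at this
      exact this.trans hV1
  have e1 : chordal S U' ^ 2 = ∑ j, ‖Real.cos (s j) • x j + Real.sin (s j) • y j‖ ^ 2 := by
    rw [chordal_eq_frobNorm_of_isRep hrep, ← Matrix.mul_assoc,
      frobNorm_mul_transpose_of_isometry hQ, frobNorm_sq_eq_sum_colVec]
    exact Finset.sum_congr rfl fun j _ => by rw [hZc]
  have e2 : chordal S U ^ 2 = ∑ j, ‖x j‖ ^ 2 := by
    rw [chordal_eq_frobNorm_of_isRep hX, ← hright, frobNorm_sq_eq_sum_colVec]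
  have e3 : frobNorm (P * V) ^ 2 = ∑ j, s j ^ 2 * ‖y j‖ ^ 2 := by
    rw [← hright, frobNorm_sq_eq_sum_colVec]
    exact Finset.sum_congr rfl fun j _ => by
      rw [hVc, norm_smul, mul_pow, Real.norm_eq_abs, sq_abs]
  have e4 : trace ((P * X)ᵀ * (P * V)) = ∑ j, s j * inner ℝ (x j) (y j) := by
    have : trace ((P * X)ᵀ * (P * V)) = trace ((P * X * Q₂)ᵀ * (P * V * Q₂)) := by
      rw [transpose_mul (P * X) Q₂, Matrix.mul_assoc, trace_mul_comm Q₂ᵀ, Matrix.mul_assoc,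
        Matrix.mul_assoc, hQ', Matrix.mul_one]
    rw [this, trace]
    refine Finset.sum_congr rfl fun j _ => ?_
    rw [← inner_smul_right, ← hVc, PiLp.inner_apply]
    simp [mul_apply, hx, mul_comm]
  rw [e1, e2, e3, e4, Finset.mul_sum, Finset.mul_sum, ← Finset.sum_add_distrib,
    ← Finset.sum_add_distrib]
  exact Finset.sum_le_sum fun j _ => norm_sq_rotation_le _ _ (hs j) (hs1 j)

end ExpStep

/-! ### Noise bound, contraction of one step, gradient dominance -/

section Descent

variable {n d : ℕ}

/-- The columns of `P_U P_S^⊥` lie in `U`, where `P_S` shrinks lengths by a factor no smaller than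
`√(1 - r²)`. Both the contraction and the gradient dominance rest on this. -/
lemma sqrt_mul_chordal_le_frobNorm {S U : Grass n d} {r : ℝ} (hr : chordal S U ≤ r)
    (hr1 : r < 1) :
    Real.sqrt (1 - r ^ 2) * chordal S U ≤ frobNorm (proj S * (proj U * (1 - proj S))) := by
  have h : chordal S U = frobNorm (proj U * (1 - proj S)) := by
    rw [chordal_eq_frobNorm, ← frobNorm_transpose, transpose_mul, proj_transpose,
      one_sub_proj_transpose]
  rw [h]
  exact le_frobNorm_mul_of_colVec (Real.sqrt_nonneg _) fun j =>
    sqrt_mul_norm_le_norm_proj hr hr1 (colVec_proj_mul_mem _ _ _)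

/-- Column `j` lies, up to noise, in a subspace at distance at most `c (T - 1 - j)` from `U t`.
Replacing the clean signal's norm by that of the sample costs another `ε`, whence the term `ε c (T -
1)`; Minkowski's inequality combines the columns. -/
lemma frobNorm_mul_window_le_delta {T t : ℕ} {U : ℕ → Grass n d} {u : ℕ → EuclideanSpace ℝ (Fin n)}
    {ε c : ℝ} (h_meas : ∀ t, 1 ≤ t → ∃ ubar e : EuclideanSpace ℝ (Fin n),
      u t = ubar + e ∧ ubar ∈ (U t).1 ∧ ‖e‖ ≤ ε)
    (hc : 0 ≤ c) (h_var : ∀ t, 1 ≤ t → chordal (U t) (U (t + 1)) ≤ c) (hTt : T ≤ t) :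
    frobNorm ((1 - proj (U t)) * window u T t) ≤ delta u T ε c t := by
  have hε : 0 ≤ ε := by
    obtain ⟨_, e, -, -, he⟩ := h_meas 1 le_rfl
    exact (norm_nonneg e).trans he
  have hdist : ∀ s m : ℕ, 1 ≤ s → chordal (U s) (U (s + m)) ≤ c * m := by
    intro s m hs
    induction m with
    | zero =>
      have : chordal (U s) (U s) = 0 := by
        rw [chordal_eq_frobNorm, one_sub_proj_mul_proj]
        simp [frobNorm]
      simp [this]
    | succ m ih =>
      refine (chordal_triangle _ (U (s + m)) _).trans ?_
      have := h_var (s + m) (by omega)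
      rw [← add_assoc]
      push_cast
      linarith
  set W := window u T t with hW
  have hcol : ∀ j : Fin T, ‖colVec ((1 - proj (U t)) * W) j‖ ≤
      c * (((T : ℝ) - 1 - (j : ℕ)) * ‖colVec W j‖) + ε * (c * ((T : ℝ) - 1) + 1) := by
    intro j
    have hj := j.2
    obtain ⟨ubar, e, hu, hmem, he⟩ := h_meas (t - T + 1 + j) (by omega)
    have hWj : colVec W j = ubar + e := by
      rw [← hu]
      rfl
    have hubar : ‖ubar‖ ≤ ‖colVec W j‖ + ε := by
      have : ubar = colVec W j - e := by rw [hWj, add_sub_cancel_right]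
      rw [this]
      exact (norm_sub_le _ _).trans (by linarith)
    have hD : chordal (U t) (U (t - T + 1 + j)) ≤ c * ((T : ℝ) - 1 - (j : ℕ)) := by
      have h1 := hdist (t - T + 1 + j) (T - 1 - j) (by omega)
      have h2 : t - T + 1 + j + (T - 1 - j) = t := by omega
      have h3 : ((T - 1 - j : ℕ) : ℝ) = (T : ℝ) - 1 - (j : ℕ) := by
        rw [Nat.cast_sub (by omega), Nat.cast_sub (by omega), Nat.cast_one]
      rw [h2, h3] at h1
      rwa [chordal_comm]
    have hT0 : (0 : ℝ) ≤ (T : ℝ) - 1 - (j : ℕ) := by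
      have : (j : ℝ) + 1 ≤ T := by exact_mod_cast hj
      linarith
    have h1 : ‖toEuclideanLin (1 - proj (U t)) ubar‖ ≤
        c * ((T : ℝ) - 1 - (j : ℕ)) * (‖colVec W j‖ + ε) :=
      (norm_one_sub_proj_le hmem).trans
        (mul_le_mul hD hubar (norm_nonneg _) (mul_nonneg hc hT0))
    have h2 : ‖toEuclideanLin (1 - proj (U t)) e‖ ≤ ε := by
      have := (opLe_one_sub_proj (U t)).2 e
      linarith
    have h3 : ‖colVec ((1 - proj (U t)) * W) j‖ ≤
        ‖toEuclideanLin (1 - proj (U t)) ubar‖ + ‖toEuclideanLin (1 - proj (U t)) e‖ := by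
      rw [colVec_mul, hWj, map_add]
      exact norm_add_le _ _
    have h4 : c * ((T : ℝ) - 1 - (j : ℕ)) * ε ≤ c * ((T : ℝ) - 1) * ε := by
      refine mul_le_mul_of_nonneg_right (mul_le_mul_of_nonneg_left ?_ hc) hε
      have : (0 : ℝ) ≤ (j : ℕ) := Nat.cast_nonneg _
      linarith
    nlinarith
  set b : ℝ := ε * (c * ((T : ℝ) - 1) + 1) with hb
  set a : EuclideanSpace ℝ (Fin T) :=
    WithLp.toLp 2 fun j : Fin T => c * (((T : ℝ) - 1 - (j : ℕ)) * ‖colVec W j‖) with ha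
  set v : EuclideanSpace ℝ (Fin T) := WithLp.toLp 2 fun _ => b with hv
  have hnorm_a : ‖a‖ = c * frobNorm (W * diagonal fun j : Fin T => (T : ℝ) - 1 - (j : ℕ)) := by
    refine (sq_eq_sq₀ (norm_nonneg _) (mul_nonneg hc (frobNorm_nonneg _))).1 ?_
    rw [mul_pow, frobNorm_sq_eq_sum_colVec, EuclideanSpace.norm_sq_eq, Finset.mul_sum]
    refine Finset.sum_congr rfl fun j _ => ?_
    have : colVec (W * diagonal fun j : Fin T => (T : ℝ) - 1 - (j : ℕ)) j =
        ((T : ℝ) - 1 - (j : ℕ)) • colVec W j := by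
      ext i
      simp [mul_comm]
    rw [this, norm_smul, Real.norm_eq_abs, Real.norm_eq_abs, sq_abs, mul_pow, mul_pow, mul_pow,
      sq_abs]
  -- For `T = 0` the real number `T - 1` is `-1`, and `b` could be negative.
  rcases Nat.eq_zero_or_pos T with hT0 | hTpos
  · subst hT0
    have h0 : frobNorm ((1 - proj (U t)) * W) = 0 := by simp [frobNorm]
    rw [h0, delta, ← hW, ← hnorm_a]
    simp
  have hb0 : 0 ≤ b := by
    have : (1 : ℝ) ≤ T := by exact_mod_cast hTpos
    exact mul_nonneg hε (add_nonneg (mul_nonneg hc (by linarith)) zero_le_one)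
  have hnorm_v : ‖v‖ = Real.sqrt T * b := by
    rw [EuclideanSpace.norm_eq]
    simp [hv, Real.sqrt_sq hb0]
  have hle : frobNorm ((1 - proj (U t)) * W) ≤ ‖a + v‖ := by
    refine abs_le_of_sq_le_sq' ?_ (norm_nonneg _) |>.2
    rw [frobNorm_sq_eq_sum_colVec, EuclideanSpace.norm_sq_eq]
    refine Finset.sum_le_sum fun j _ => ?_
    rw [Real.norm_eq_abs, sq_abs]
    exact pow_le_pow_left₀ (norm_nonneg _) (hcol j) 2
  refine (hle.trans (norm_add_le a v)).trans (le_of_eq ?_)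
  rw [hnorm_a, hnorm_v, delta, hb]
  ring

/-- One noisy gradient step contracts the squared distance to the true subspace up to `γ`. -/
lemma IsGradStep.chordal_sq_le {T : ℕ} {W : Matrix (Fin n) (Fin T) ℝ} {S U U' : Grass n d}
    {α σlo σhi r δ : ℝ} (h : IsGradStep α W U U') (hα : 0 < α)
    (hhi : OpLe (proj S * W) σhi) (hσlo : 0 ≤ σlo)
    (hlo : ∀ x ∈ S.1, σlo * ‖x‖ ≤ ‖toEuclideanLin (proj S * W)ᵀ x‖)
    (hδ : frobNorm ((1 - proj S) * W) ≤ δ) (hr : chordal S U ≤ r) (hr1 : r < 1)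
    (hκ : 0 ≤ α * σlo ^ 2 - 2 * α ^ 2 * σhi ^ 4)
    (hsmall : 2 * α * (r * σhi ^ 2 + (2 * σhi * δ + δ ^ 2)) ≤ 3 / 2) :
    chordal S U' ^ 2 ≤ rhoTilde α σlo σhi r * chordal S U ^ 2 + gamma α σhi r δ := by
  obtain ⟨X, G, hX, hG, hexp⟩ := h
  have hGe : G = (1 - X * Xᵀ) * (-(2 : ℝ) • (W * Wᵀ * X)) :=
    hG.unique hX.1 (hasRiemannianGradAt_cost W X)
  have hσ0 := hhi.1
  have hδ0 : 0 ≤ δ := (frobNorm_nonneg _).trans hδ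
  have hr0 : 0 ≤ r := (chordal_nonneg _ _).trans hr
  have hXop := opLe_of_isometry hX.1
  have hPop := opLe_proj S
  have hPcop := opLe_one_sub_proj S
  have hRop := opLe_one_sub_proj U
  have hPP := proj_mul_self S
  have hPcP := one_sub_proj_mul_proj S
  have hPt := proj_transpose S
  have hPct := one_sub_proj_transpose S
  have hQt := proj_transpose U
  have hQe := hX.proj_eq
  have hhc : chordal S U = frobNorm ((1 - proj S) * X) := chordal_eq_frobNorm_of_isRep hX
  have hhQ : chordal S U = frobNorm ((1 - proj S) * proj U) := chordal_eq_frobNorm S U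
  have hRP : frobNorm ((1 - proj U) * proj S) ≤ r := by
    rw [← chordal_eq_frobNorm, chordal_comm]
    exact hr
  have hgl := sqrt_mul_chordal_le_frobNorm hr hr1
  set A := proj S * W with hA
  set N := (1 - proj S) * W with hN
  have hPA : proj S * A = A := by rw [hA, ← Matrix.mul_assoc, hPP]
  have hPcA : (1 - proj S) * A = 0 := by rw [hA, ← Matrix.mul_assoc, hPcP, Matrix.zero_mul]
  have hR : 1 - X * Xᵀ = 1 - proj U := by rw [hQe]
  rw [hR] at hGe
  have hPPc : proj S + (1 - proj S) = 1 := add_sub_cancel _ _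
  have hmem := fun B : Matrix (Fin n) (Fin n) ℝ => colVec_proj_mul_mem S B
  have hRA : (1 - proj U) * A = A - proj U * A := by rw [Matrix.sub_mul, Matrix.one_mul]
  have hXR : Xᵀ * (1 - proj U) = 0 := by
    rw [hQe, Matrix.mul_sub, ← Matrix.mul_assoc, hX.1, Matrix.mul_one, Matrix.one_mul, sub_self]
  have hstep := fun (V : Matrix (Fin n) (Fin d) ℝ) (h0 : Xᵀ * V = 0) (h1 : frobNorm V ≤ 3 / 2)
    (h : IsExp X V U') => h.chordal_sq_le (S := S) hX h0 h1
  set P := proj S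
  set Pc := 1 - P
  set Q := proj U
  set R := 1 - Q
  clear_value A N Pc R P Q
  set b := 2 * σhi * δ + δ ^ 2 with hb
  -- The part of `W Wᵀ` involving noise; `b` bounds `‖E X‖_F`.
  set E := A * Nᵀ + N * Aᵀ + N * Nᵀ with hE
  have hW : W * Wᵀ = A * Aᵀ + E := by
    have : W = A + N := by
      rw [hA, hN, ← Matrix.add_mul, hPPc, Matrix.one_mul]
    rw [hE]
    nth_rw 1 2 [this]
    simp only [transpose_add, Matrix.add_mul, Matrix.mul_add]
    abel
  have hEX : frobNorm (E * X) ≤ b := by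
    have hNt : frobNorm (Nᵀ * X) ≤ δ := by
      have := frobNorm_mul_le_right hXop Nᵀ
      rw [frobNorm_transpose, mul_one] at this
      exact this.trans hδ
    have e1 : frobNorm (A * (Nᵀ * X)) ≤ σhi * δ :=
      (frobNorm_mul_le hhi _).trans (mul_le_mul_of_nonneg_left hNt hσ0)
    have e2 : frobNorm (N * (Aᵀ * X)) ≤ δ * (σhi * 1) :=
      (frobNorm_mul_le_right (hhi.transpose.mul hXop) N).trans
        (mul_le_mul_of_nonneg_right hδ (by linarith))
    have e3 : frobNorm (N * (Nᵀ * X)) ≤ δ * δ :=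
      (frobNorm_mul_le (opLe_frobNorm N) _).trans
        (mul_le_mul hδ hNt (frobNorm_nonneg _) hδ0)
    have e4 : E * X = A * (Nᵀ * X) + N * (Aᵀ * X) + N * (Nᵀ * X) := by
      rw [hE, Matrix.add_mul, Matrix.add_mul, Matrix.mul_assoc, Matrix.mul_assoc,
        Matrix.mul_assoc N Nᵀ]
    rw [e4]
    have e5 := frobNorm_add_le (A * (Nᵀ * X) + N * (Aᵀ * X)) (N * (Nᵀ * X))
    have e6 := frobNorm_add_le (A * (Nᵀ * X)) (N * (Aᵀ * X))
    rw [hb]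
    linarith
  have hb0 : 0 ≤ b := (frobNorm_nonneg _).trans hEX
  have hAAX : OpLe (A * (Aᵀ * X)) (σhi * (σhi * 1)) := hhi.mul (hhi.transpose.mul hXop)
  set V := -(α • G) with hV
  have hVe : V = (2 * α) • (R * (A * (Aᵀ * X)) + R * (E * X)) := by
    rw [hV, hGe, hW, Matrix.mul_smul, smul_smul, ← neg_smul, Matrix.add_mul, Matrix.mul_add,
      Matrix.mul_assoc A]
    congr 1
    ring
  have hXV : Xᵀ * V = 0 := by
    rw [hVe, Matrix.mul_smul, Matrix.mul_add, ← Matrix.mul_assoc, ← Matrix.mul_assoc Xᵀ R, hXR,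
      Matrix.zero_mul, Matrix.zero_mul, add_zero, smul_zero]
  have hREX : frobNorm (R * (E * X)) ≤ b :=
    (frobNorm_mul_le hRop _).trans (by rwa [one_mul])
  -- Since `A = P A`, the signal part carries the factor `R P`, whose Frobenius norm is the chordal
  -- distance.
  have hVn : frobNorm V ≤ 3 / 2 := by
    have e1 : frobNorm (R * (A * (Aᵀ * X))) ≤ r * (σhi * (σhi * 1)) := by
      have : R * (A * (Aᵀ * X)) = R * P * (A * (Aᵀ * X)) := by
        rw [Matrix.mul_assoc R, ← Matrix.mul_assoc P, hPA]
      rw [this]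
      exact (frobNorm_mul_le_right hAAX _).trans
        (mul_le_mul_of_nonneg_right hRP hAAX.1)
    have e2 := frobNorm_add_le (R * (A * (Aᵀ * X))) (R * (E * X))
    rw [hVe, frobNorm_smul, abs_of_pos (by linarith)]
    refine le_trans (mul_le_mul_of_nonneg_left (e2.trans (add_le_add e1 hREX)) (by linarith)) ?_
    refine le_trans (le_of_eq ?_) hsmall
    ring
  have hstep := hstep V hXV hVn hexp
  -- Gain and curvature are both measured by `g` rather than by the distance, so that the factor `1
  -- - r²` multiplies their difference as a whole.
  set g := frobNorm (P * (Q * Pc)) with hg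
  have hg0 : 0 ≤ g := frobNorm_nonneg _
  have hgt : frobNorm (Pc * Q * P) = g := by
    rw [hg, ← frobNorm_transpose]
    simp only [transpose_mul, hPt, hPct, hQt, Matrix.mul_assoc]
  have hgr : g ≤ r := by
    rw [← hgt]
    have := frobNorm_mul_le_right hPop (Pc * Q)
    rw [mul_one, ← hhQ] at this
    exact this.trans hr
  -- The sign that makes this a descent step: `Pc A = 0`, so only `-Q` survives from `R = 1 - Q`.
  have hPcRA : Pc * (R * A) = -(Pc * Q * A) := by
    rw [hRA, Matrix.mul_sub, hPcA, zero_sub, Matrix.mul_assoc]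
  -- After transposition `Aᵀ` acts on columns lying in `S`, where it expands by `σlo`.
  have hsig : σlo * g ≤ frobNorm (Pc * Q * A) := by
    have : frobNorm (Pc * Q * A) = frobNorm (Aᵀ * (P * (Q * Pc))) := by
      rw [← frobNorm_transpose (Pc * Q * A), ← hPA]
      simp only [transpose_mul, hPt, hPct, hQt, Matrix.mul_assoc]
      rw [← Matrix.mul_assoc P P, hPP]
    rw [this]
    exact le_frobNorm_mul_of_colVec hσlo fun j => hlo _ (hmem _ j)
  have htr1 : trace ((Pc * X)ᵀ * (Pc * (R * (A * (Aᵀ * X))))) = -frobNorm (Pc * Q * A) ^ 2 := by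
    have e1 : (Pc * X)ᵀ * (Pc * (R * (A * (Aᵀ * X)))) =
        Xᵀ * ((Pc * (Pc * (R * A))) * (Aᵀ * X)) := by
      simp only [transpose_mul, hPct, Matrix.mul_assoc]
    have e2 : frobNorm (Pc * Q * A) ^ 2 = trace (Aᵀ * Q * (Pc * (Pc * Q * A))) := by
      rw [frobNorm_sq_eq_trace]
      simp only [transpose_mul, hPct, hQt, Matrix.mul_assoc]
    rw [e1, e2, hPcRA, trace_mul_comm, hQe, ← trace_neg, Matrix.mul_assoc, trace_mul_comm]
    congr 1
    simp only [Matrix.mul_assoc, Matrix.mul_neg]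
  have htr2 : trace ((Pc * X)ᵀ * (Pc * (R * (E * X)))) ≤ r * b := by
    refine (le_abs_self _).trans ((abs_trace_transpose_mul_le _ _).trans ?_)
    rw [← hhc]
    refine mul_le_mul hr ?_ (frobNorm_nonneg _) hr0
    exact (frobNorm_mul_le hPcop _).trans (by rwa [one_mul])
  have hPcV : Pc * V = (2 * α) • (Pc * (R * (A * (Aᵀ * X))) + Pc * (R * (E * X))) := by
    rw [hVe, Matrix.mul_smul, Matrix.mul_add]
  have hPcVn : frobNorm (Pc * V) ≤ 2 * α * (g * σhi ^ 2 + b) := by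
    have e1 : frobNorm (Pc * (R * (A * (Aᵀ * X)))) ≤ g * (σhi * (σhi * 1)) := by
      have : Pc * (R * (A * (Aᵀ * X))) = -(Pc * Q * P * (A * (Aᵀ * X))) := by
        rw [← Matrix.mul_assoc R, ← Matrix.mul_assoc Pc, hPcRA, Matrix.neg_mul,
          Matrix.mul_assoc (Pc * Q) P, ← Matrix.mul_assoc P A, hPA, Matrix.mul_assoc (Pc * Q)]
      rw [this, frobNorm_neg, ← hgt]
      exact frobNorm_mul_le_right hAAX _
    have e2 : frobNorm (Pc * (R * (E * X))) ≤ b :=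
      (frobNorm_mul_le hPcop _).trans (by rwa [one_mul])
    rw [hPcV, frobNorm_smul, abs_of_pos (by linarith)]
    refine mul_le_mul_of_nonneg_left ?_ (by linarith)
    refine (frobNorm_add_le _ _).trans ?_
    refine (add_le_add e1 e2).trans (le_of_eq ?_)
    ring
  have htr : trace ((Pc * X)ᵀ * (Pc * V)) ≤ 2 * α * (-(σlo * g) ^ 2 + r * b) := by
    rw [hPcV, Matrix.mul_smul, trace_smul, smul_eq_mul, Matrix.mul_add, trace_add, htr1]
    refine mul_le_mul_of_nonneg_left ?_ (by linarith)
    have := pow_le_pow_left₀ (mul_nonneg hσlo hg0) hsig 2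
    linarith
  have hsq : frobNorm (Pc * V) ^ 2 ≤
      (2 * α) ^ 2 * (g ^ 2 * σhi ^ 4 + 2 * r * σhi ^ 2 * b + b ^ 2) := by
    refine (pow_le_pow_left₀ (frobNorm_nonneg _) hPcVn 2).trans ?_
    rw [mul_pow]
    refine mul_le_mul_of_nonneg_left ?_ (sq_nonneg _)
    linear_combination 2 * mul_le_mul_of_nonneg_right hgr (mul_nonneg (sq_nonneg σhi) hb0)
  have hg2 : (1 - r ^ 2) * chordal S U ^ 2 ≤ g ^ 2 := by
    have := pow_le_pow_left₀ (mul_nonneg (Real.sqrt_nonneg _) (chordal_nonneg S U)) hgl 2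
    rwa [mul_pow, Real.sq_sqrt (by nlinarith)] at this
  have hfin := mul_le_mul_of_nonneg_left hg2 hκ
  -- `γ` collects exactly the terms containing `b`, with `g ≤ r` used in the cross term.
  have hγ : gamma α σhi r δ = 4 * α * (r * b) + 8 * α ^ 2 * (2 * r * σhi ^ 2 * b + b ^ 2) := by
    rw [gamma, hb]
    ring
  rw [hγ, rhoTilde]
  linear_combination hstep + 2 * htr + 2 * hsq + 4 * hfin

/-- Gradient dominance of the squared chordal distance. -/
lemma le_frobNorm_grad_chordal_sq {S U : Grass n d} {X G : Matrix (Fin n) (Fin d) ℝ} {r : ℝ}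
    (hX : IsRep X U) (hr : chordal U S ≤ r) (hr1 : r < 1)
    (hG : HasRiemannianGradAt (fun V => chordal V S ^ 2) X G) :
    4 * (1 - r ^ 2) * chordal U S ^ 2 ≤ frobNorm G ^ 2 := by
  have hr0 := (chordal_nonneg _ _).trans hr
  have h := sqrt_mul_chordal_le_frobNorm hr hr1
  have h2 := pow_le_pow_left₀ (mul_nonneg (Real.sqrt_nonneg _) (chordal_nonneg U S)) h 2
  rw [mul_pow, Real.sq_sqrt (by nlinarith)] at h2
  -- Multiplying by the isometry `Xᵀ` turns `X` into `P_U`; transposing gives `h` with the roles of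
  -- `S` and `U` exchanged.
  have hGe : frobNorm G = 2 * frobNorm (proj U * (proj S * (1 - proj U))) := by
    rw [hG.unique hX.1 (hasRiemannianGradAt_chordal_sq S X), Matrix.mul_smul, frobNorm_smul,
      ← frobNorm_mul_transpose_of_isometry hX.1, Matrix.mul_assoc, Matrix.mul_assoc, ← hX.proj_eq,
      ← frobNorm_transpose]
    simp only [transpose_mul, proj_transpose, one_sub_proj_transpose, Matrix.mul_assoc]
    norm_num
  rw [hGe, mul_pow]
  linarith

end Descent

/-! ### Affine recursion and step length -/

section Recursion

/-- An affine recursion with a noise level as in the signal-to-noise condition stays below `r²`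
and reaches `(r - c)²` after `K` steps. -/
lemma affine_recursion_bound {h : ℕ → ℝ} {ρ γ r c : ℝ} {K : ℕ} (hρ0 : 0 ≤ ρ) (hρ1 : ρ < 1)
    (hc : 0 ≤ c) (hcr : c ≤ r) (hK : 0 < K) (h0 : h 0 ≤ r ^ 2)
    (hstep : ∀ k < K, h k ≤ r ^ 2 → h (k + 1) ≤ ρ * h k + γ)
    (hγ : γ ≤ (1 - ρ) * r ^ 2 + (1 - ρ) * (c ^ 2 - 2 * c * r) / (1 - ρ ^ K)) :
    (∀ k ≤ K, h k ≤ r ^ 2) ∧ h K ≤ (r - c) ^ 2 := by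
  have hden : 0 < 1 - ρ ^ K := sub_pos.2 (pow_lt_one₀ hρ0 hρ1 hK.ne')
  have hw : c ^ 2 - 2 * c * r ≤ 0 := by nlinarith
  have hneg : ∀ k, (c ^ 2 - 2 * c * r) * (1 - ρ ^ k) / (1 - ρ ^ K) ≤ 0 := fun k =>
    div_nonpos_of_nonpos_of_nonneg
      (mul_nonpos_of_nonpos_of_nonneg hw (sub_nonneg.2 (pow_le_one₀ hρ0 hρ1.le))) hden.le
  -- The right side solves the recursion with equality in `hγ`, starting at `r²` and equal to `(r -
  -- c)²` at `k = K`. It never exceeds `r²`, so `hstep` stays applicable.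
  have hinv : ∀ k ≤ K, h k ≤ r ^ 2 + (c ^ 2 - 2 * c * r) * (1 - ρ ^ k) / (1 - ρ ^ K) := by
    intro k
    induction k with
    | zero => intro _; simpa using h0
    | succ k ih =>
      intro hk
      have h1 := ih (by omega)
      have h2 := hstep k (by omega) (h1.trans (by linarith [hneg k]))
      have h3 := mul_le_mul_of_nonneg_left h1 hρ0
      refine (h2.trans (add_le_add h3 hγ)).trans (le_of_eq ?_)
      field_simp
      ring
  refine ⟨fun k hk => (hinv k hk).trans (by linarith [hneg k]), ?_⟩
  refine (hinv K le_rfl).trans (le_of_eq ?_)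
  rw [mul_div_assoc, div_self hden.ne']
  ring

/-- The step size condition makes the contraction factor strictly less than one. -/
lemma step_size_gain_pos {α σlo σhi : ℝ} (hσlo : 0 < σlo) (hσ : σlo ≤ σhi) (hα : 0 < α)
    (hα' : α < σlo ^ 2 / (2 * σhi ^ 4)) :
    0 < α * σlo ^ 2 - 2 * α ^ 2 * σhi ^ 4 ∧ 2 * (α * σhi ^ 2) < 1 := by
  have hhi : 0 < σhi := hσlo.trans_le hσ
  rw [lt_div_iff₀ (by positivity)] at hα'
  refine ⟨by nlinarith, ?_⟩
  have h1 : σlo ^ 2 ≤ σhi ^ 2 := pow_le_pow_left₀ hσlo.le hσ 2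
  have h2 : 2 * (α * σhi ^ 2) * σhi ^ 2 < 1 * σhi ^ 2 := by nlinarith
  exact lt_of_mul_lt_mul_right h2 (by positivity)

/-- The signal-to-noise condition bounds the length of a gradient step. -/
lemma step_length_le_of_gamma_le {α σlo σhi r δ : ℝ} (hσlo : 0 < σlo) (hσ : σlo ≤ σhi)
    (hα : 0 < α) (hα' : α < σlo ^ 2 / (2 * σhi ^ 4)) (hr0 : 0 ≤ r) (hr1 : r < 1) (hδ : 0 ≤ δ)
    (hγ : gamma α σhi r δ ≤ (1 - rhoTilde α σlo σhi r) * r ^ 2) :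
    2 * α * (r * σhi ^ 2 + (2 * σhi * δ + δ ^ 2)) ≤ 3 / 2 := by
  obtain ⟨hκ, hp⟩ := step_size_gain_pos hσlo hσ hα hα'
  have hhi : 0 < σhi := hσlo.trans_le hσ
  have hlo2 : σlo ^ 2 ≤ σhi ^ 2 := pow_le_pow_left₀ hσlo.le hσ 2
  -- With `p = α σhi²` the left side is at most `p - 2 p² ≤ 1/8`; together with `hr2` this gives `γ
  -- ≤ 4 * (1/4) * (1/8)`.
  have hκ8 : α * σlo ^ 2 - 2 * α ^ 2 * σhi ^ 4 ≤ 1 / 8 := by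
    nlinarith [sq_nonneg (4 * (α * σhi ^ 2) - 1), mul_le_mul_of_nonneg_left hlo2 hα.le]
  have hr2 : r ^ 2 * (1 - r ^ 2) ≤ 1 / 4 := by nlinarith [sq_nonneg (2 * r ^ 2 - 1)]
  have hr2' : 0 ≤ r ^ 2 * (1 - r ^ 2) := mul_nonneg (sq_nonneg r) (by nlinarith)
  have hle : gamma α σhi r δ ≤ 1 / 8 := by
    refine hγ.trans ?_
    have : (1 - rhoTilde α σlo σhi r) * r ^ 2 =
        4 * ((r ^ 2 * (1 - r ^ 2)) * (α * σlo ^ 2 - 2 * α ^ 2 * σhi ^ 4)) := by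
      rw [rhoTilde]
      ring
    rw [this]
    nlinarith [mul_le_mul hr2 hκ8 hκ.le (by norm_num : (0 : ℝ) ≤ 1 / 4)]
  -- Isolating two squares in `γ` bounds `α δ²` by `1/8` and `α σhi δ` by `1/16`. With `2 α σhi² <
  -- 1` the step length is then at most `1 + 1/4 + 1/4`.
  have hg : gamma α σhi r δ = 8 * (α * δ ^ 2) ^ 2 + 32 * (α * σhi * δ) ^ 2 +
      (8 * α * r * σhi * (1 + 4 * α * σhi ^ 2) * δ + 4 * α * r * δ ^ 2 +
        16 * α ^ 2 * σhi ^ 2 * r * δ ^ 2 + 32 * α ^ 2 * σhi * δ ^ 3) := by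
    rw [gamma]
    ring
  have hrest : 0 ≤ 8 * α * r * σhi * (1 + 4 * α * σhi ^ 2) * δ + 4 * α * r * δ ^ 2 +
        16 * α ^ 2 * σhi ^ 2 * r * δ ^ 2 + 32 * α ^ 2 * σhi * δ ^ 3 := by positivity
  have h1 : α * δ ^ 2 ≤ 1 / 8 :=
    abs_le_of_sq_le_sq' (by nlinarith [sq_nonneg (α * σhi * δ)]) (by norm_num) |>.2
  have h2 : α * σhi * δ ≤ 1 / 16 :=
    abs_le_of_sq_le_sq' (by nlinarith [sq_nonneg (α * δ ^ 2)]) (by norm_num) |>.2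
  have h3 : α * σhi ^ 2 * r ≤ α * σhi ^ 2 * 1 :=
    mul_le_mul_of_nonneg_left hr1.le (by positivity)
  nlinarith

end Recursion

end GREAT

/-! ### Main theorem: induction over the time windows -/

theorem lemma4 {n d : ℕ} (hd : 0 < d)
    -- true subspaces and samples (used for times `t ≥ 1`)
    (U : ℕ → GREAT.Grass n d) (u : ℕ → EuclideanSpace ℝ (Fin n))
    (ε c σlo σhi α r_b : ℝ) (T t₀ K : ℕ)
    -- bounded measurement error
    (h_meas : ∀ t, 1 ≤ t → ∃ ubar e : EuclideanSpace ℝ (Fin n),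
      u t = ubar + e ∧ ubar ∈ (U t).1 ∧ ‖e‖ ≤ ε)
    -- bounded rate of change of the subspaces
    (hc : 0 ≤ c) (h_var : ∀ t, 1 ≤ t → GREAT.chordal (U t) (U (t + 1)) ≤ c)
    -- bounds on the singular values of the signal
    (hσlo : 0 < σlo) (hσ : σlo ≤ σhi)
    (h_sig : ∀ t, T ≤ t →
      GREAT.sigma 1 (GREAT.proj (U t) * GREAT.window u T t) ≤ σhi ∧
      σlo ≤ GREAT.sigma d (GREAT.proj (U t) * GREAT.window u T t))
    -- admissible inputs of the algorithm
    (ht₀ : d ≤ t₀) (hdT : d ≤ T) (hT : T ≤ t₀ + 1) (hK : 0 < K)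
    (hα : 0 < α) (hα' : α < σlo ^ 2 / (2 * σhi ^ 4))
    -- a run of the algorithm
    (est : ℕ → GREAT.Grass n d) (iter : ℕ → ℕ → GREAT.Grass n d)
    (h_run : GREAT.IsRun u T t₀ K α est iter)
    -- initial estimate, signal-to-noise ratio and step size
    (hcr : c ≤ r_b) (hr : r_b < 1)
    (h_init : est t₀ ∈ GREAT.chordalBall r_b (U (t₀ + 1)))
    (hρ : 0 ≤ GREAT.rhoTilde α σlo σhi r_b)
    (h_snr : ∀ t, t₀ + 1 ≤ t →
      GREAT.gamma α σhi r_b (GREAT.delta u T ε c t) ≤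
        (1 - GREAT.rhoTilde α σlo σhi r_b) * r_b ^ 2 +
        (1 - GREAT.rhoTilde α σlo σhi r_b) * (c ^ 2 - 2 * c * r_b) /
          (1 - GREAT.rhoTilde α σlo σhi r_b ^ K)) :
    ∀ t, t₀ + 1 ≤ t → ∀ k, k ≤ K →
      iter t k ∈ GREAT.chordalBall r_b (U t) ∧
      ∀ X : Matrix (Fin n) (Fin d) ℝ, GREAT.IsRep X (iter t k) →
        (∃ G, GREAT.HasRiemannianGradAt (fun V => GREAT.chordal V (U t) ^ 2) X G) ∧
        ∀ G, GREAT.HasRiemannianGradAt (fun V => GREAT.chordal V (U t) ^ 2) X G →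
          4 * (1 - r_b ^ 2) * GREAT.chordal (iter t k) (U t) ^ 2 ≤ GREAT.frobNorm G ^ 2 := by
  intro t
  have hr0 : 0 ≤ r_b := hc.trans hcr
  obtain ⟨hκ, -⟩ := GREAT.step_size_gain_pos hσlo hσ hα hα'
  have hρ1 : GREAT.rhoTilde α σlo σhi r_b < 1 := by
    have : 0 < (1 - r_b ^ 2) * (α * σlo ^ 2 - 2 * α ^ 2 * σhi ^ 4) :=
      mul_pos (by nlinarith) hκ
    rw [GREAT.rhoTilde]
    linarith
  -- A window entered within `r_b` is left within `r_b - c`; this slack pays for the motion of the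
  -- true subspace in `hstart`.
  have window_bound : ∀ t, t₀ + 1 ≤ t → GREAT.chordal (U t) (iter t 0) ≤ r_b →
      (∀ k ≤ K, GREAT.chordal (U t) (iter t k) ≤ r_b) ∧
        GREAT.chordal (U t) (iter t K) ≤ r_b - c := by
    intro t ht h0
    have hTt : T ≤ t := hT.trans ht
    have hδ := GREAT.frobNorm_mul_window_le_delta (T := T) h_meas hc h_var hTt
    have hγ := h_snr t ht
    have hγ' : GREAT.gamma α σhi r_b (GREAT.delta u T ε c t) ≤
        (1 - GREAT.rhoTilde α σlo σhi r_b) * r_b ^ 2 := by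
      have : (1 - GREAT.rhoTilde α σlo σhi r_b) * (c ^ 2 - 2 * c * r_b) /
          (1 - GREAT.rhoTilde α σlo σhi r_b ^ K) ≤ 0 :=
        div_nonpos_of_nonpos_of_nonneg
          (mul_nonpos_of_nonneg_of_nonpos (by linarith) (by nlinarith))
          (sub_nonneg.2 (pow_le_one₀ hρ hρ1.le))
      linarith
    have hsmall := GREAT.step_length_le_of_gamma_le hσlo hσ hα hα' hr0 hr
      ((GREAT.frobNorm_nonneg _).trans hδ) hγ'
    have hrec := GREAT.affine_recursion_bound
      (h := fun k => GREAT.chordal (U t) (iter t k) ^ 2) hρ hρ1 hc hcr hK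
      (pow_le_pow_left₀ (GREAT.chordal_nonneg _ _) h0 2)
      (fun k hk hle => (h_run.step t ht k hk).chordal_sq_le hα
        (GREAT.opLe_of_sigma_one_le (h_sig t hTt).1) hσlo.le
        (fun x hx => GREAT.mul_norm_le_of_le_sigma hσlo hdT (h_sig t hTt).2 hx) hδ
        (abs_le_of_sq_le_sq' hle hr0).2 hr hκ.le hsmall) hγ
    exact ⟨fun k hk => (abs_le_of_sq_le_sq' (hrec.1 k hk) hr0).2,
      (abs_le_of_sq_le_sq' hrec.2 (by linarith)).2⟩
  intro ht
  have hstart : GREAT.chordal (U t) (iter t 0) ≤ r_b := by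
    induction t, ht using Nat.le_induction with
    | base =>
      rw [h_run.init _ le_rfl]
      exact h_init
    | succ t ht ih =>
      rw [h_run.init (t + 1) (by omega), Nat.add_sub_cancel, h_run.update t ht]
      have h1 := (window_bound t ht ih).2
      have h2 := h_var t (by omega)
      rw [GREAT.chordal_comm] at h2
      have h3 := GREAT.chordal_triangle (U (t + 1)) (U t) (iter t K)
      linarith
  intro k hk
  have hball := (window_bound t ht hstart).1 k hk
  refine ⟨hball, fun X hX => ⟨⟨_, GREAT.hasRiemannianGradAt_chordal_sq (U t) X⟩, fun G hG => ?_⟩⟩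
  exact GREAT.le_frobNorm_grad_chordal_sq hX (by rwa [GREAT.chordal_comm]) hr hG
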